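/- **Lemma.** Let $\pi=p_0p_1\cdots p_n$ and $\sigma=q_0q_1\cdots q_m$ be polygonal curves in $\mathbb R^d$, each with at least one edge and with distinct consecutive vertices, parameterized by arc length on $[0,\|\pi\|]$ and $[0,\|\sigma\|]$. Let $D=[0,\|\pi\|]\times[0,\|\sigma\|]$ be their free space diagram, with the elevation function $e(x,y)=\|\pi(x)-\sigma(y)\|$ and the grid whose cells correspond to pairs of edges. *CDTW.* A monotone morphing is a non-self-intersecting curve $\mathfrak m\subseteq D$ from $(0,0)$ to $(\|\pi\|,\|\sigma\|)$ that is nondecreasing in both coordinates. Its warping cost is $\int_0^{\|\pi\|}\min_{y:(x,y)\in \mathfrak m}e(x,y)\,dx+\int_0^{\|\sigma\|}\min_{x:(x,y)\in \mathfrak m}e(x,y)\,dy$, and $d_{TW}(\pi,\sigma)$ is the infimum of the warping costs of all monotone morphings. *VE graph.* It has one vertex (a portal) for each grid edge, located at the unique point of minimum elevation on this edge, except that the portals on the grid edges adjacent to the bottom left corner $s$ and to the top right corner $t$ of $D$ are moved to $s$ and $t$. In each grid cell there are directed edges from the portals of its left and bottom edges to the portals of its right and top edges. The price of a segment from $(x_1,y_1)$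 to $(x_2,y_2)$ in $D$ is $(|x_2-x_1|+|y_2-y_1|)\int_0^1 e\big((1-t)(x_1,y_1)+t(x_2,y_2)\big)\,dt$, i.e. the sum, over the two subsegments matched by it, of the integral of the leash length along the subsegment when both points move linearly. The price of a polygonal path is the sum of the prices of its segments. *Sweep distance.* Compute a shortest (cheapest) $s$–$t$ path in the VE graph. If it is not $x/y$-monotone, one may perform a round of bisection refinement: insert a vertex in the middle of each maximal portion of either curve that the path travels backward, and recompute a shortest path in the VE graph of the refined curves. A *run* consists of finitely many (possibly zero) such rounds, with any choice among equally short paths; it may stop at any time, in particular once the shortest path is monotone. Let $\gamma$ be the final shortest path. The sweep distance $d_{SW}(\pi,\sigma)$ computed by the run is the price of the monotone morphing associated with $\gamma$, which is obtained by replacing the $k$-th vertex $(x_k,y_k)$ of $\gamma$ by $(\max_{j\le k}x_j,\max_{j\le k}y_j)$; it is $\gamma$ itself if $\gamma$ is monotone. *Claim.* Let $\pi^i,\sigma^i$ be the curves obtained from $\pi,\sigma$ by $i$ iterations of splitting, where splitting a curve inserts a vertex at the middle of each of its edges. Then for every $i$ a run on $(\pi^i,\sigma^i)$ exists, and, for any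 choice of one run on $(\pi^i,\sigma^i)$ for each $i$, $$\lim_{i\to\infty}d_{SW}(\pi^i,\sigma^i)=d_{TW}(\pi,\sigma),$$ where $d_{SW}(\pi^i,\sigma^i)$ is the value computed by the chosen run. The prices of the shortest paths found at the end of the runs converge to the same limit; in particular, so do the prices of the shortest $s$–$t$ paths in the VE graphs of $\pi^i,\sigma^i$ themselves. -/

import Mathlib

open Filter Topology Set

noncomputable section

namespace Sweep

/-- A polygonal curve `vtx 0, vtx 1, …, vtx n` in `ℝ^d` with `n ≥ 1` edges, consecutive vertices being
distinct.  The values `vtx k` with `k > n` are irrelevant. -/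
structure PolyCurve (d : ℕ) where
  n : ℕ
  vtx : ℕ → EuclideanSpace ℝ (Fin d)
  n_pos : 0 < n
  vtx_ne : ∀ k < n, vtx k ≠ vtx (k + 1)

namespace PolyCurve

variable {d : ℕ} (C : PolyCurve d)

/-- Length of the `k`-th edge. -/
def edgeLen (k : ℕ) : ℝ := dist (C.vtx k) (C.vtx (k + 1))

/-- Unit direction vector of the `k`-th edge. -/
def dir (k : ℕ) : EuclideanSpace ℝ (Fin d) := (C.edgeLen k)⁻¹ • (C.vtx (k + 1) - C.vtx k)

/-- Distance along the curve from its first vertex to its `k`-th vertex. -/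
def arc (k : ℕ) : ℝ := ∑ i ∈ Finset.range k, C.edgeLen i

/-- Total length of the curve. -/
def length : ℝ := C.arc C.n

/-- Uniform (arc length) parameterization: `param x` is reached from `vtx 0` by moving along each edge
`k` by the part of `[0, x]` lying in `[arc k, arc (k+1)]`.  See `param_eq`. -/
def param (x : ℝ) : EuclideanSpace ℝ (Fin d) :=
  C.vtx 0 + ∑ k ∈ Finset.range C.n, max 0 (min (C.edgeLen k) (x - C.arc k)) • C.dir k

/-- The parameters of the vertices. -/
def breaks : Set ℝ := {x | ∃ k ≤ C.n, x = C.arc k}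

theorem edgeLen_nonneg (k : ℕ) : 0 ≤ C.edgeLen k := dist_nonneg

theorem edgeLen_pos {k : ℕ} (hk : k < C.n) : 0 < C.edgeLen k := dist_pos.2 (C.vtx_ne k hk)

theorem arc_succ (k : ℕ) : C.arc (k + 1) = C.arc k + C.edgeLen k := Finset.sum_range_succ _ _

theorem arc_mono : Monotone C.arc :=
  monotone_nat_of_le_succ fun k => by rw [arc_succ]; linarith [C.edgeLen_nonneg k]

theorem edgeLen_smul_dir {k : ℕ} (hk : k < C.n) :
    C.edgeLen k • C.dir k = C.vtx (k + 1) - C.vtx k := by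
  rw [dir, smul_smul, mul_inv_cancel₀ (C.edgeLen_pos hk).ne', one_smul]

theorem norm_dir {k : ℕ} (hk : k < C.n) : ‖C.dir k‖ = 1 := by
  have h := C.edgeLen_pos hk
  have h2 : ‖C.vtx (k + 1) - C.vtx k‖ = C.edgeLen k := by
    rw [← dist_eq_norm, dist_comm]; rfl
  rw [dir, norm_smul, h2, norm_inv, Real.norm_of_nonneg h.le, inv_mul_cancel₀ h.ne']

/-- On the `k`-th edge the parameterization has unit speed from `vtx k` towards `vtx (k+1)`. -/
theorem param_eq {k : ℕ} (hk : k < C.n) {x : ℝ} (hx : x ∈ Icc (C.arc k) (C.arc (k + 1))) :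
    C.param x = C.vtx k + (x - C.arc k) • C.dir k := by
  have hx1 := hx.1
  have hx2 := hx.2
  have key : ∀ N, N ≤ C.n → C.vtx 0 + ∑ i ∈ Finset.range N,
      max 0 (min (C.edgeLen i) (x - C.arc i)) • C.dir i
        = if N ≤ k then C.vtx N else C.vtx k + (x - C.arc k) • C.dir k := by
    intro N
    induction N with
    | zero => intro _; simp
    | succ N ih =>
      intro hN
      rw [Finset.sum_range_succ, ← add_assoc, ih (by omega)]
      rcases lt_trichotomy N k with h | h | h
      · have h1 : C.arc (N + 1) ≤ C.arc k := C.arc_mono h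
        rw [arc_succ] at h1
        rw [if_pos h.le, if_pos (by omega), min_eq_left (by linarith),
          max_eq_right (C.edgeLen_nonneg N), C.edgeLen_smul_dir (by omega)]
        abel
      · subst h
        rw [arc_succ] at hx2
        rw [if_pos le_rfl, if_neg (by omega), min_eq_right (by linarith),
          max_eq_right (by linarith)]
      · have h1 : C.arc (k + 1) ≤ C.arc N := C.arc_mono h
        rw [if_neg (by omega), if_neg (by omega),
          max_eq_left ((min_le_right _ _).trans (by linarith)), zero_smul, add_zero]
  rw [param, key C.n le_rfl, if_neg (by omega)]

/-- Parameter of the point of the `k`-th edge that is closest to `p`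
(see `footParam_mem`, `dist_footParam_lt`). -/
def footParam (k : ℕ) (p : EuclideanSpace ℝ (Fin d)) : ℝ :=
  C.arc k + max 0 (min (C.edgeLen k) (inner ℝ (p - C.vtx k) (C.dir k)))

theorem footParam_mem (k : ℕ) (p : EuclideanSpace ℝ (Fin d)) :
    C.footParam k p ∈ Icc (C.arc k) (C.arc (k + 1)) := by
  rw [arc_succ, footParam]
  have := C.edgeLen_nonneg k
  exact ⟨by linarith [le_max_left 0 (min (C.edgeLen k) (inner ℝ (p - C.vtx k) (C.dir k)))],
    by linarith [max_le this (min_le_left (C.edgeLen k) (inner ℝ (p - C.vtx k) (C.dir k)))]⟩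

/-- `footParam` is the unique minimum of the distance to `p` along the `k`-th edge. -/
theorem dist_footParam_lt {k : ℕ} (hk : k < C.n) (p : EuclideanSpace ℝ (Fin d)) {y : ℝ}
    (hy : y ∈ Icc (C.arc k) (C.arc (k + 1))) (hne : y ≠ C.footParam k p) :
    dist p (C.param (C.footParam k p)) < dist p (C.param y) := by
  rw [C.param_eq hk hy, C.param_eq hk (C.footParam_mem k p)]
  have hsq : ∀ s : ℝ, dist p (C.vtx k + s • C.dir k) ^ 2
      = ‖p - C.vtx k‖ ^ 2 - 2 * s * inner ℝ (p - C.vtx k) (C.dir k) + s ^ 2 := by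
    intro s
    rw [dist_eq_norm, ← sub_sub, norm_sub_sq_real, inner_smul_right, norm_smul, C.norm_dir hk,
      mul_one, Real.norm_eq_abs, sq_abs]
    ring
  apply lt_of_pow_lt_pow_left₀ 2 dist_nonneg
  rw [hsq, hsq]
  have hfoot : C.footParam k p - C.arc k
      = max 0 (min (C.edgeLen k) (inner ℝ (p - C.vtx k) (C.dir k))) := by
    rw [footParam]; ring
  have hne' : y - C.arc k ≠ C.footParam k p - C.arc k := fun h => hne (by linarith)
  rw [hfoot] at hne' ⊢
  have h0 := hy.1
  have h1 := hy.2
  rw [arc_succ] at h1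
  set s := y - C.arc k with hs
  have hs0 : 0 ≤ s := by linarith
  have hs1 : s ≤ C.edgeLen k := by linarith
  set c := inner ℝ (p - C.vtx k) (C.dir k)
  set f := max 0 (min (C.edgeLen k) c) with hf
  have hpos : 0 < (s - f) ^ 2 := by
    have := sub_ne_zero.2 hne'
    positivity
  have hprod : 0 ≤ (s - f) * (f - c) := by
    rcases le_total c 0 with hc | hc
    · have : f = 0 := max_eq_left ((min_le_right _ _).trans hc)
      rw [this]; nlinarith
    · rcases le_total c (C.edgeLen k) with hc' | hc'
      · have : f = c := by rw [hf, min_eq_right hc', max_eq_right hc]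
        rw [this]; simp
      · have : f = C.edgeLen k := by
          rw [hf, min_eq_left hc', max_eq_right (C.edgeLen_nonneg k)]
        rw [this]; nlinarith
  nlinarith

/-- The splitting of a curve: a vertex is inserted at the middle of every edge. -/
def split : PolyCurve d where
  n := 2 * C.n
  vtx k := if k % 2 = 0 then C.vtx (k / 2) else midpoint ℝ (C.vtx (k / 2)) (C.vtx (k / 2 + 1))
  n_pos := by have := C.n_pos; omega
  vtx_ne := by
    intro k hk
    have hne := C.vtx_ne (k / 2) (by omega)
    rcases Nat.mod_two_eq_zero_or_one k with h | h
    · have h1 : (k + 1) % 2 ≠ 0 := by omega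
      have h2 : (k + 1) / 2 = k / 2 := by omega
      simp only [if_pos h, if_neg h1, h2]
      exact fun e => hne ((midpoint_eq_left_iff (R := ℝ)).1 e.symm)
    · have h0 : k % 2 ≠ 0 := by omega
      have h1 : (k + 1) % 2 = 0 := by omega
      have h2 : (k + 1) / 2 = k / 2 + 1 := by omega
      simp only [if_neg h0, if_pos h1, h2]
      exact fun e => hne ((midpoint_eq_right_iff (R := ℝ)).1 e)

end PolyCurve

variable {d : ℕ}

/-- Elevation function on the free space diagram `[0, A.length] × [0, B.length]`. -/
def elev (A B : PolyCurve d) (z : ℝ × ℝ) : ℝ := dist (A.param z.1) (B.param z.2)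

/-! ### Morphings and continuous dynamic time warping -/

/-- A morphing: a non-self-intersecting curve in the free space diagram from its bottom left corner to
its top right corner. -/
structure Morphing (A B : PolyCurve d) where
  path : Path ((0 : ℝ), (0 : ℝ)) (A.length, B.length)
  injective : Function.Injective path
  mem_diagram : ∀ t, path t ∈ Icc (0 : ℝ) A.length ×ˢ Icc (0 : ℝ) B.length

/-- `x/y`-monotone morphings (the order on `ℝ × ℝ` is the coordinatewise one). -/
def Morphing.IsMonotone {A B : PolyCurve d} (m : Morphing A B) : Prop := Monotone m.path

/-- Length of the shortest leash attached to the point `A.param x` during the morphing `m`. -/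
def leashLeft {A B : PolyCurve d} (m : Morphing A B) (x : ℝ) : ℝ :=
  sInf {r | ∃ y, (x, y) ∈ Set.range m.path ∧ r = elev A B (x, y)}

/-- Length of the shortest leash attached to the point `B.param y` during the morphing `m`. -/
def leashRight {A B : PolyCurve d} (m : Morphing A B) (y : ℝ) : ℝ :=
  sInf {r | ∃ x, (x, y) ∈ Set.range m.path ∧ r = elev A B (x, y)}

/-- Warping cost of a morphing. -/
def warpingCost {A B : PolyCurve d} (m : Morphing A B) : ℝ :=
  (∫ x in (0 : ℝ)..A.length, leashLeft m x) + ∫ y in (0 : ℝ)..B.length, leashRight m y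

/-- Continuous dynamic time warping distance. -/
def cdtw (A B : PolyCurve d) : ℝ :=
  sInf {c | ∃ m : Morphing A B, m.IsMonotone ∧ c = warpingCost m}

/-! ### The VE graph -/

/-- Vertices of the VE graph, one for each edge of the grid: `vert i j` lies on the vertical grid edge
`{x_i} × [y_j, y_{j+1}]` and `horiz i j` on the horizontal grid edge `[x_i, x_{i+1}] × {y_j}`, where
`x_i = A.arc i` and `y_j = B.arc j`. -/
inductive VENode where
  | vert (i j : ℕ)
  | horiz (i j : ℕ)

/-- Location of a vertex of the VE graph: the portal of the grid edge, that is the point of minimum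
elevation on it, except that it is moved to the bottom left (top right) corner of the diagram if the
grid edge is adjacent to that corner. -/
def loc (A B : PolyCurve d) : VENode → ℝ × ℝ
  | .vert i j =>
      if i = 0 ∧ j = 0 then (0, 0)
      else if i = A.n ∧ j + 1 = B.n then (A.length, B.length)
      else (A.arc i, B.footParam j (A.vtx i))
  | .horiz i j =>
      if i = 0 ∧ j = 0 then (0, 0)
      else if i + 1 = A.n ∧ j = B.n then (A.length, B.length)
      else (A.footParam i (B.vtx j), B.arc j)

/-- Edges of the VE graph: in every grid cell `(i, j)`, from the portals of its left and bottom edges to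
the portals of its right and top edges. -/
def VEAdj (A B : PolyCurve d) (u v : VENode) : Prop :=
  ∃ i < A.n, ∃ j < B.n,
    (u = .vert i j ∨ u = .horiz i j) ∧ (v = .vert (i + 1) j ∨ v = .horiz i (j + 1))

/-- The vertices that were moved to the bottom left corner `s`. -/
def IsStart (u : VENode) : Prop := u = .vert 0 0 ∨ u = .horiz 0 0

/-- The vertices that were moved to the top right corner `t`. -/
def IsTarget (A B : PolyCurve d) (u : VENode) : Prop :=
  u = .vert A.n (B.n - 1) ∨ u = .horiz (A.n - 1) B.n

/-- Directed paths from `s` to `t` in the VE graph, as lists of vertices. -/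
structure IsVEPath (A B : PolyCurve d) (γ : List VENode) : Prop where
  chain : γ.IsChain (VEAdj A B)
  start : ∃ u ∈ γ.head?, IsStart u
  target : ∃ u ∈ γ.getLast?, IsTarget A B u

/-- The polygonal path in the diagram that is traced by a path of the VE graph. -/
def trace (A B : PolyCurve d) (γ : List VENode) : List (ℝ × ℝ) := γ.map (loc A B)

/-- Let two points move at constant speed, simultaneously, according to the segment from `z` to `w` of the
diagram.  If a moving point covers a subsegment of length `ℓ`, then its price is the integral over
`x ∈ [0, ℓ]` of the leash length at the moment at which it has covered the distance `x`. -/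
def legPrice (A B : PolyCurve d) (z w : ℝ × ℝ) (ℓ : ℝ) : ℝ :=
  ∫ x in (0 : ℝ)..ℓ, elev A B (AffineMap.lineMap z w (x / ℓ))

/-- Price of a segment of the diagram: the sum of the prices of the two subsegments it matches. -/
def segPrice (A B : PolyCurve d) (z w : ℝ × ℝ) : ℝ :=
  legPrice A B z w |w.1 - z.1| + legPrice A B z w |w.2 - z.2|

/-- Price of a polygonal path of the diagram. -/
def polyPrice (A B : PolyCurve d) : List (ℝ × ℝ) → ℝ
  | z :: w :: l => segPrice A B z w + polyPrice A B (w :: l)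
  | _ => 0

/-- Shortest `s`-`t` paths in the VE graph with respect to the price. -/
def IsShortestVEPath (A B : PolyCurve d) (γ : List VENode) : Prop :=
  IsVEPath A B γ ∧
    ∀ γ', IsVEPath A B γ' → polyPrice A B (trace A B γ) ≤ polyPrice A B (trace A B γ')

/-! ### Making the path monotone -/

/-- Direct monotonization of `(x_1, y_1), (x_2, y_2), …`: the `i`-th point of the result is
`(max (x_1, …, x_i), max (y_1, …, y_i))`. -/
def monotonize : List (ℝ × ℝ) → List (ℝ × ℝ)
  | [] => []
  | z :: l => z :: (monotonize l).map (fun w => z ⊔ w)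

/-- Midpoints of the portions that are travelled backward: the numbers `(a + b) / 2` for all maximal
runs `a > … > b` of at least two consecutive terms of `l`. -/
def backwardMidpoints (l : List ℝ) : Set ℝ :=
  {c | ∃ l₁ r l₂ : List ℝ, ∃ a b : ℝ, l = l₁ ++ r ++ l₂ ∧ r.IsChain (· > ·) ∧
    a ∈ r.head? ∧ b ∈ r.getLast? ∧ b < a ∧
    (∀ p ∈ l₁.getLast?, p ≤ a) ∧ (∀ q ∈ l₂.head?, b ≤ q) ∧ c = (a + b) / 2}

/-- `C'` is the refinement of the curve `C` by new vertices at the parameters in `S`. -/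
def IsInsertion (C : PolyCurve d) (S : Set ℝ) (C' : PolyCurve d) : Prop :=
  C'.length = C.length ∧ (∀ x ∈ Icc 0 C.length, C'.param x = C.param x) ∧
    C'.breaks = C.breaks ∪ S

/-- One round of bisection refinement of the pair of curves `P`: if a shortest path in the VE graph is not
monotone, then a vertex is inserted in the middle of each portion of either curve that is travelled
backward. -/
def BisectionRound (P P' : PolyCurve d × PolyCurve d) : Prop :=
  ∃ γ, IsShortestVEPath P.1 P.2 γ ∧ ¬ (trace P.1 P.2 γ).IsChain (· ≤ ·) ∧
    IsInsertion P.1 (backwardMidpoints ((trace P.1 P.2 γ).map Prod.fst)) P'.1 ∧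
    IsInsertion P.2 (backwardMidpoints ((trace P.1 P.2 γ).map Prod.snd)) P'.2

/-- A run of the sweep distance computation for `A` and `B`: finitely many rounds of bisection refinement
(possibly none), and then a shortest path in the VE graph of the refined curves `A'` and `B'`.  The run
may, but need not, end with a monotone shortest path. -/
structure SweepRun (A B : PolyCurve d) where
  A' : PolyCurve d
  B' : PolyCurve d
  rounds : Relation.ReflTransGen BisectionRound (A, B) (A', B')
  γ : List VENode
  shortest : IsShortestVEPath A' B' γ

/-- Price of the shortest path found by the run. -/
def SweepRun.pathPrice {A B : PolyCurve d} (R : SweepRun A B) : ℝ :=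
  polyPrice R.A' R.B' (trace R.A' R.B' R.γ)

/-- The sweep distance computed by the run: the price of the monotone morphing associated with the
shortest path.  If the shortest path is monotone, then the morphing is the path itself
(see `monotonize_eq_self`). -/
def SweepRun.sweepDist {A B : PolyCurve d} (R : SweepRun A B) : ℝ :=
  polyPrice R.A' R.B' (monotonize (trace R.A' R.B' R.γ))

theorem monotonize_eq_self {l : List (ℝ × ℝ)} (h : l.IsChain (· ≤ ·)) : monotonize l = l := by
  rw [List.isChain_iff_pairwise] at h
  induction l with
  | nil => rfl
  | cons z l ih =>
    rw [List.pairwise_cons] at h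
    rw [monotonize, ih h.2]
    congr 1
    conv_rhs => rw [← List.map_id l]
    exact List.map_congr_left fun w hw => sup_eq_right.2 (h.1 w hw)

end Sweep

end

/-! The limit follows from a sandwich. If all edges of the refined curves have length at most δ,
then the distance `cdtw` of the original curves is at most the sweep distance, which exceeds the
price of the shortest path by at most 2δ(‖π‖ + ‖σ‖); and the price of the shortest path is at most
`cdtw` + η as soon as δ is small enough for η. Refining changes neither the elevation function nor
the total lengths and never lengthens an edge, so bisection rounds are harmless, and δ → 0 because
splitting halves every edge.

Lower bound (`IsVEPath.cdtw_le`): a monotone polygonal path from s to t is a morphing, and its price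
is at least its warping cost, since the shortest leash at a point is no longer than the leash used
by the path.

Monotonization (`IsVEPath.polyPrice_monotonize_le`): columns and rows never decrease along a VE
path, so each coordinate drops by at most δ below any earlier value. Taking running maxima moves
vertices by at most δ per coordinate and lengthens no displacement; the elevation is 1-Lipschitz in
each coordinate, and the monotone path has total displacement ‖π‖ + ‖σ‖.

Upper bound (`exists_mesh_polyPrice_le`): sample a nearly optimal monotone morphing finely, and
replace it by a staircase of K steps whose cost is close to the warping cost. With K fixed, route a
VE path along the staircase. Climbing along a vertical segment at x uses the portals on the
horizontal edges of one column; they lie within δ of x. The number of portals grows as δ → 0, so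
their sideways movement needs a bound on total variation: while a point runs along one original edge
of σ, its foot on a fixed edge of length at most δ moves monotonically. The sideways movement is
thus at most δ times the number of original edges (`sum_abs_footParam_sub_le`). Each of the 2K
axis-parallel segments costs O(δ) extra, which vanishes in the limit. -/

noncomputable section

namespace Sweep

/-! ### Lipschitz continuity of the arc length parameterization -/

namespace PolyCurve

theorem arc_zero {d : ℕ} (C : PolyCurve d) : C.arc 0 = 0 := Finset.sum_range_zero _

theorem arc_nonneg {d : ℕ} (C : PolyCurve d) (k : ℕ) : 0 ≤ C.arc k :=
  C.arc_zero ▸ C.arc_mono (Nat.zero_le k)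

theorem arc_le_length {d : ℕ} (C : PolyCurve d) {k : ℕ} (hk : k ≤ C.n) : C.arc k ≤ C.length :=
  C.arc_mono hk

theorem length_nonneg {d : ℕ} (C : PolyCurve d) : 0 ≤ C.length := C.arc_nonneg _

theorem arc_lt_arc_succ {d : ℕ} (C : PolyCurve d) {k : ℕ} (hk : k < C.n) :
    C.arc k < C.arc (k + 1) := by
  rw [arc_succ]; linarith [C.edgeLen_pos hk]

theorem length_pos {d : ℕ} (C : PolyCurve d) : 0 < C.length := by
  have h := C.arc_lt_arc_succ C.n_pos
  rw [arc_zero] at h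
  exact h.trans_le (C.arc_le_length C.n_pos)

theorem sum_clamp {d : ℕ} (C : PolyCurve d) (N : ℕ) (x : ℝ) :
    ∑ k ∈ Finset.range N, max 0 (min (C.edgeLen k) (x - C.arc k)) = max 0 (min (C.arc N) x) := by
  induction N with
  | zero => simp [arc_zero]
  | succ N ih =>
    rw [Finset.sum_range_succ, ih, arc_succ]
    have h1 := C.arc_nonneg N
    have h2 := C.edgeLen_nonneg N
    simp only [max_def, min_def]
    split_ifs <;> linarith

/-- Between two parameters each edge contributes a vector whose norm is the length covered on it,
and these lengths add up by `sum_clamp`. The clamped form yields both the Lipschitz bound and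
constancy outside the parameter interval. -/
theorem dist_param_le_clamp {d : ℕ} (C : PolyCurve d) (x y : ℝ) :
    dist (C.param x) (C.param y) ≤ |max 0 (min C.length x) - max 0 (min C.length y)| := by
  wlog h : y ≤ x generalizing x y
  · rw [dist_comm, abs_sub_comm]
    exact this y x (le_of_not_ge h)
  rw [param, param, dist_add_left, dist_eq_norm, ← Finset.sum_sub_distrib]
  refine le_trans ?_ (le_abs_self _)
  rw [length, ← sum_clamp, ← sum_clamp, ← Finset.sum_sub_distrib]
  refine norm_sum_le_of_le _ fun k hk => ?_
  rw [← sub_smul, norm_smul, C.norm_dir (Finset.mem_range.1 hk), mul_one, Real.norm_of_nonneg]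
  rw [sub_nonneg]
  gcongr

theorem dist_param_le {d : ℕ} (C : PolyCurve d) (x y : ℝ) :
    dist (C.param x) (C.param y) ≤ |x - y| := by
  refine (C.dist_param_le_clamp x y).trans ?_
  refine (abs_max_sub_max_le_max _ _ _ _).trans (max_le (by simp) ?_)
  exact (abs_min_sub_min_le_max _ _ _ _).trans (max_le (by simp) le_rfl)

theorem param_clamp {d : ℕ} (C : PolyCurve d) (x : ℝ) :
    C.param (max 0 (min C.length x)) = C.param x := by
  rw [← dist_le_zero]
  refine (C.dist_param_le_clamp _ _).trans ?_
  have h := C.length_nonneg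
  rw [min_eq_right (max_le h (min_le_left _ _)), max_eq_right (le_max_left _ _)]
  simp

theorem continuous_param {d : ℕ} (C : PolyCurve d) : Continuous C.param :=
  (LipschitzWith.of_dist_le_mul (K := 1) fun x y => by
    simpa [Real.dist_eq] using C.dist_param_le x y).continuous

theorem param_arc {d : ℕ} (C : PolyCurve d) {k : ℕ} (hk : k ≤ C.n) :
    C.param (C.arc k) = C.vtx k := by
  rcases hk.lt_or_eq with h | h
  · rw [C.param_eq h ⟨le_rfl, C.arc_mono k.le_succ⟩]; simp
  · obtain ⟨m, hm⟩ := Nat.exists_eq_succ_of_ne_zero C.n_pos.ne'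
    have hm' : m < C.n := by omega
    obtain rfl : k = m + 1 := by omega
    rw [C.param_eq hm' ⟨C.arc_mono m.le_succ, le_rfl⟩, arc_succ, add_sub_cancel_left,
      C.edgeLen_smul_dir hm']
    abel

end PolyCurve

/-! ### Elevation and prices of segments -/

theorem elev_nonneg {d : ℕ} (A B : PolyCurve d) (z : ℝ × ℝ) : 0 ≤ elev A B z := dist_nonneg

theorem elev_le_add {d : ℕ} (A B : PolyCurve d) (z w : ℝ × ℝ) :
    elev A B z ≤ elev A B w + |z.1 - w.1| + |z.2 - w.2| := by
  have h := dist_triangle4 (A.param z.1) (A.param w.1) (B.param w.2) (B.param z.2)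
  have h1 := A.dist_param_le z.1 w.1
  have h2 := B.dist_param_le w.2 z.2
  rw [abs_sub_comm] at h2
  unfold elev
  linarith

theorem continuous_elev {d : ℕ} (A B : PolyCurve d) : Continuous (elev A B) :=
  (A.continuous_param.comp continuous_fst).dist (B.continuous_param.comp continuous_snd)

/-- An upper bound for the elevation function. -/
def elevBound {d : ℕ} (A B : PolyCurve d) : ℝ := elev A B (0, 0) + A.length + B.length

theorem elev_le_elevBound {d : ℕ} (A B : PolyCurve d) (z : ℝ × ℝ) :
    elev A B z ≤ elevBound A B := by
  have h : elev A B z = elev A B (max 0 (min A.length z.1), max 0 (min B.length z.2)) := by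
    simp only [elev, PolyCurve.param_clamp]
  rw [h]
  refine (elev_le_add A B _ (0, 0)).trans ?_
  have h1 := A.length_nonneg
  have h2 := B.length_nonneg
  simp only [sub_zero, abs_of_nonneg (le_max_left (0 : ℝ) _), elevBound]
  gcongr
  · exact max_le h1 (min_le_left _ _)
  · exact max_le h2 (min_le_left _ _)

theorem elevBound_nonneg {d : ℕ} (A B : PolyCurve d) : 0 ≤ elevBound A B :=
  (elev_nonneg A B 0).trans (elev_le_elevBound A B 0)

theorem elev_swap {d : ℕ} (A B : PolyCurve d) (z : ℝ × ℝ) : elev B A z.swap = elev A B z :=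
  dist_comm _ _

/-- The mean elevation along a segment. -/
def meanElev {d : ℕ} (A B : PolyCurve d) (z w : ℝ × ℝ) : ℝ :=
  ∫ t in (0 : ℝ)..1, elev A B (AffineMap.lineMap z w t)

theorem continuous_elev_lineMap {d : ℕ} (A B : PolyCurve d) (z w : ℝ × ℝ) :
    Continuous fun t : ℝ => elev A B (AffineMap.lineMap z w t) :=
  (continuous_elev A B).comp AffineMap.lineMap_continuous

theorem legPrice_eq {d : ℕ} (A B : PolyCurve d) (z w : ℝ × ℝ) (l : ℝ) :
    legPrice A B z w l = l * meanElev A B z w := by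
  rcases eq_or_ne l 0 with rfl | h
  · simp [legPrice]
  · have := intervalIntegral.integral_comp_div (a := 0) (b := l)
      (fun t => elev A B (AffineMap.lineMap z w t)) h
    rw [legPrice, meanElev, this, zero_div, div_self h, smul_eq_mul]

theorem segPrice_eq {d : ℕ} (A B : PolyCurve d) (z w : ℝ × ℝ) :
    segPrice A B z w = (|w.1 - z.1| + |w.2 - z.2|) * meanElev A B z w := by
  rw [segPrice, legPrice_eq, legPrice_eq, add_mul]

theorem meanElev_nonneg {d : ℕ} (A B : PolyCurve d) (z w : ℝ × ℝ) : 0 ≤ meanElev A B z w :=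
  intervalIntegral.integral_nonneg zero_le_one fun _ _ => elev_nonneg _ _ _

theorem meanElev_le_elevBound {d : ℕ} (A B : PolyCurve d) (z w : ℝ × ℝ) :
    meanElev A B z w ≤ elevBound A B := by
  have := intervalIntegral.integral_mono_on (μ := MeasureTheory.volume) zero_le_one
    ((continuous_elev_lineMap A B z w).intervalIntegrable 0 1)
    (intervalIntegrable_const (c := elevBound A B))
    fun t _ => elev_le_elevBound A B _
  simpa [meanElev] using this

theorem meanElev_swap {d : ℕ} (A B : PolyCurve d) (z w : ℝ × ℝ) :
    meanElev B A z.swap w.swap = meanElev A B z w := by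
  unfold meanElev
  congr 1 with t
  rw [← elev_swap A B]
  congr 1

theorem segPrice_swap {d : ℕ} (A B : PolyCurve d) (z w : ℝ × ℝ) :
    segPrice B A z.swap w.swap = segPrice A B z w := by
  rw [segPrice_eq, segPrice_eq, meanElev_swap, add_comm]
  simp

/-- Points at equal times on two segments differ by a convex combination of the differences of the
endpoints, so bounds at the endpoints persist. -/
theorem elev_lineMap_le {d : ℕ} (A B : PolyCurve d) {z w z' w' : ℝ × ℝ} {r s t : ℝ}
    (ht : t ∈ Icc (0 : ℝ) 1) (hz1 : |z.1 - z'.1| ≤ r) (hw1 : |w.1 - w'.1| ≤ r)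
    (hz2 : |z.2 - z'.2| ≤ s) (hw2 : |w.2 - w'.2| ≤ s) :
    elev A B (AffineMap.lineMap z w t) ≤ elev A B (AffineMap.lineMap z' w' t) + r + s := by
  have key : ∀ {p q p' q' c : ℝ}, |p - p'| ≤ c → |q - q'| ≤ c →
      |(p + t * (q - p)) - (p' + t * (q' - p'))| ≤ c := by
    intro p q p' q' c h1 h2
    have e : (p + t * (q - p)) - (p' + t * (q' - p')) = (1 - t) * (p - p') + t * (q - q') := by
      ring
    rw [abs_le] at *
    have := ht.1
    have := ht.2
    rw [e]
    constructor <;> nlinarith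
  refine (elev_le_add A B _ (AffineMap.lineMap z' w' t)).trans ?_
  have e1 : ∀ a b : ℝ × ℝ, (AffineMap.lineMap a b t : ℝ × ℝ) =
      (a.1 + t * (b.1 - a.1), a.2 + t * (b.2 - a.2)) := by
    intro a b
    ext <;> simp [AffineMap.lineMap_apply] <;> ring
  simp only [e1]
  gcongr
  · exact key hz1 hw1
  · exact key hz2 hw2

theorem meanElev_le_add {d : ℕ} (A B : PolyCurve d) {z w z' w' : ℝ × ℝ} {r s : ℝ}
    (hz1 : |z.1 - z'.1| ≤ r) (hw1 : |w.1 - w'.1| ≤ r)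
    (hz2 : |z.2 - z'.2| ≤ s) (hw2 : |w.2 - w'.2| ≤ s) :
    meanElev A B z w ≤ meanElev A B z' w' + r + s := by
  have h1 := (continuous_elev_lineMap A B z' w').intervalIntegrable (μ := MeasureTheory.volume) 0 1
  have := intervalIntegral.integral_mono_on (μ := MeasureTheory.volume) zero_le_one
    ((continuous_elev_lineMap A B z w).intervalIntegrable 0 1)
    (h1.add (intervalIntegrable_const (c := r + s)))
    fun t ht => (elev_lineMap_le A B ht hz1 hw1 hz2 hw2).trans_eq (add_assoc _ _ _)
  rw [intervalIntegral.integral_add h1 intervalIntegrable_const] at this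
  simpa [meanElev, add_assoc] using this

theorem polyPrice_congr {d : ℕ} {A B A' B' : PolyCurve d} (h : elev A B = elev A' B') :
    polyPrice A B = polyPrice A' B' := by
  funext l
  induction l with
  | nil => simp [polyPrice]
  | cons z l ih =>
    cases l with
    | nil => simp [polyPrice]
    | cons w l => simp only [polyPrice, ih, segPrice, legPrice, h]

/-! ### Leash lengths of a morphing -/

namespace Morphing

/-- The morphing with the roles of the two curves exchanged. -/
def swap {d : ℕ} {A B : PolyCurve d} (m : Morphing A B) : Morphing B A where
  path := m.path.map continuous_swap
  injective := fun _ _ h => m.injective (Prod.swap_injective h)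
  mem_diagram t := ⟨(m.mem_diagram t).2, (m.mem_diagram t).1⟩

theorem mem_range_swap {d : ℕ} {A B : PolyCurve d} (m : Morphing A B) (z : ℝ × ℝ) :
    z.swap ∈ Set.range m.swap.path ↔ z ∈ Set.range m.path := by
  constructor
  · rintro ⟨t, ht⟩
    exact ⟨t, Prod.swap_injective ht⟩
  · rintro ⟨t, rfl⟩
    exact ⟨t, rfl⟩

theorem IsMonotone.swap {d : ℕ} {A B : PolyCurve d} {m : Morphing A B} (h : m.IsMonotone) :
    m.swap.IsMonotone := fun _ _ hst => ⟨(h hst).2, (h hst).1⟩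

end Morphing

theorem leashLeft_swap {d : ℕ} {A B : PolyCurve d} (m : Morphing A B) :
    leashLeft m.swap = leashRight m := by
  funext y
  unfold leashLeft leashRight
  congr 1 with r
  refine exists_congr fun x => ?_
  rw [← elev_swap A B, ← m.mem_range_swap]
  rfl

theorem leashLeft_nonneg {d : ℕ} {A B : PolyCurve d} (m : Morphing A B) (x : ℝ) :
    0 ≤ leashLeft m x :=
  Real.sInf_nonneg <| by rintro _ ⟨y, -, rfl⟩; exact elev_nonneg _ _ _

theorem leashLeft_le {d : ℕ} {A B : PolyCurve d} (m : Morphing A B) {z : ℝ × ℝ}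
    (h : z ∈ Set.range m.path) : leashLeft m z.1 ≤ elev A B z :=
  csInf_le ⟨0, by rintro _ ⟨y, -, rfl⟩; exact elev_nonneg _ _ _⟩ ⟨z.2, h, rfl⟩

/-- The fibre of the morphing over `x` is compact, so the infimum is attained. -/
theorem exists_leashLeft_eq {d : ℕ} {A B : PolyCurve d} (m : Morphing A B) {x : ℝ}
    (h : x ∈ Prod.fst '' Set.range m.path) :
    ∃ y, (x, y) ∈ Set.range m.path ∧ leashLeft m x = elev A B (x, y) := by
  have hc : IsCompact (Set.range m.path ∩ {z | z.1 = x}) :=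
    (isCompact_range m.path.continuous).inter_right (isClosed_eq continuous_fst continuous_const)
  have he : {r | ∃ y, (x, y) ∈ Set.range m.path ∧ r = elev A B (x, y)}
      = elev A B '' (Set.range m.path ∩ {z | z.1 = x}) := by
    ext r
    constructor
    · rintro ⟨y, hy, rfl⟩
      exact ⟨(x, y), ⟨hy, rfl⟩, rfl⟩
    · rintro ⟨⟨_, y⟩, ⟨hy, rfl⟩, rfl⟩
      exact ⟨y, hy, rfl⟩
  obtain ⟨z, hz, rfl⟩ := h
  have := (hc.image (continuous_elev A B)).sInf_mem ⟨_, mem_image_of_mem _ ⟨hz, rfl⟩⟩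
  rw [← he] at this
  exact this

theorem leashLeft_le_elevBound {d : ℕ} {A B : PolyCurve d} (m : Morphing A B) (x : ℝ) :
    leashLeft m x ≤ elevBound A B := by
  by_cases h : ∃ y, (x, y) ∈ Set.range m.path
  · obtain ⟨y, hy⟩ := h
    exact (leashLeft_le m hy).trans (elev_le_elevBound _ _ _)
  -- Over an empty fibre the infimum has the default value 0.
  · push Not at h
    simp [leashLeft, h, elevBound_nonneg]

/-- For `c ≥ 0`, the sublevel set is the projection of a compact part of the curve, together with
the parameters over which the fibre is empty and the leash length defaults to 0. -/
theorem measurable_leashLeft {d : ℕ} {A B : PolyCurve d} (m : Morphing A B) :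
    Measurable (leashLeft m) := by
  refine measurable_of_Iic fun c => ?_
  rcases lt_or_ge c 0 with hc | hc
  · convert MeasurableSet.empty
    ext x
    simpa using hc.trans_le (leashLeft_nonneg m x)
  · have hr := isCompact_range m.path.continuous
    have h1 : IsCompact (Prod.fst '' (Set.range m.path ∩ {z | elev A B z ≤ c})) :=
      (hr.inter_right (isClosed_le (continuous_elev A B) continuous_const)).image continuous_fst
    convert h1.measurableSet.union (hr.image continuous_fst).measurableSet.compl
    ext x
    by_cases hx : x ∈ Prod.fst '' Set.range m.path
    · simp only [mem_preimage, mem_Iic, mem_union, mem_compl_iff, hx, not_true_eq_false, or_false]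
      constructor
      · intro h
        obtain ⟨y, hy, hy'⟩ := exists_leashLeft_eq m hx
        exact ⟨(x, y), ⟨hy, hy'.symm.trans_le h⟩, rfl⟩
      · rintro ⟨z, ⟨hz, hz'⟩, rfl⟩
        exact (leashLeft_le m hz).trans hz'
    · have h0 : leashLeft m x = 0 := by
        have : ∀ y, (x, y) ∉ Set.range m.path := fun y hy => hx ⟨_, hy, rfl⟩
        simp [leashLeft, this]
      simp only [mem_preimage, mem_Iic, h0, hc, mem_union, mem_compl_iff, hx, not_false_eq_true,
        or_true]

theorem intervalIntegrable_leashLeft {d : ℕ} {A B : PolyCurve d} (m : Morphing A B) (a b : ℝ) :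
    IntervalIntegrable (leashLeft m) MeasureTheory.volume a b :=
  (intervalIntegrable_const (c := elevBound A B)).mono_fun'
    (measurable_leashLeft m).aestronglyMeasurable
    (MeasureTheory.ae_of_all _ fun x => by
      simpa [abs_of_nonneg (leashLeft_nonneg m x)] using leashLeft_le_elevBound m x)

theorem warpingCost_nonneg {d : ℕ} {A B : PolyCurve d} (m : Morphing A B) :
    0 ≤ warpingCost m := by
  rw [warpingCost, ← leashLeft_swap]
  exact add_nonneg
    (intervalIntegral.integral_nonneg A.length_nonneg fun x _ => leashLeft_nonneg m x)
    (intervalIntegral.integral_nonneg B.length_nonneg fun x _ => leashLeft_nonneg m.swap x)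

theorem cdtw_le_warpingCost {d : ℕ} {A B : PolyCurve d} {m : Morphing A B} (h : m.IsMonotone) :
    cdtw A B ≤ warpingCost m :=
  csInf_le ⟨0, by rintro _ ⟨m, -, rfl⟩; exact warpingCost_nonneg m⟩ ⟨m, h, rfl⟩

/-- Each point of the segment competes in the infimum that defines the leash length at its abscissa.
For a vertical segment both sides vanish. -/
theorem integral_leashLeft_le {d : ℕ} {A B : PolyCurve d} (m : Morphing A B) {z w : ℝ × ℝ}
    (hzw : z ≤ w) (h : ∀ t ∈ Icc (0 : ℝ) 1, AffineMap.lineMap z w t ∈ Set.range m.path) :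
    ∫ x in z.1..w.1, leashLeft m x ≤ legPrice A B z w |w.1 - z.1| := by
  rw [abs_of_nonneg (sub_nonneg.2 hzw.1)]
  rcases hzw.1.eq_or_lt with he | hlt
  · simp [he, legPrice]
  have hl : 0 < w.1 - z.1 := sub_pos.2 hlt
  have e : ∫ x in z.1..w.1, leashLeft m x = ∫ x in (0 : ℝ)..(w.1 - z.1), leashLeft m (x + z.1) := by
    rw [intervalIntegral.integral_comp_add_right]; simp
  rw [e, legPrice]
  refine intervalIntegral.integral_mono_on hl.le ?_ ?_ fun x hx => ?_
  · simpa using (intervalIntegrable_leashLeft m z.1 w.1).comp_add_right z.1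
  · exact ((continuous_elev_lineMap A B z w).comp (continuous_id.div_const _)).intervalIntegrable _ _
  · have := leashLeft_le m (h (x / (w.1 - z.1)) ⟨div_nonneg hx.1 hl.le, (div_le_one hl).2 hx.2⟩)
    convert this using 2
    simp [AffineMap.lineMap_apply]
    field_simp

/-! ### Monotone polygonal paths as morphings -/

/-- Fraction of the segment from `z` to `w` that has been covered when the sum of the coordinates
reaches `s`. -/
def coveredFraction (z w : ℝ × ℝ) (s : ℝ) : ℝ :=
  max 0 (min 1 ((s - (z.1 + z.2)) / ((w.1 + w.2) - (z.1 + z.2))))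

/-- Parameterization of a polygonal monotone path by the sum of the coordinates. -/
def polyParam : List (ℝ × ℝ) → ℝ → ℝ × ℝ
  | z :: w :: l, s =>
      polyParam (w :: l) s + (AffineMap.lineMap z w (coveredFraction z w s) - w)
  | [z], _ => z
  | [], _ => 0

theorem continuous_polyParam (l : List (ℝ × ℝ)) : Continuous (polyParam l) := by
  induction l with
  | nil => exact continuous_const
  | cons z l ih =>
    cases l with
    | nil => exact continuous_const
    | cons w l =>
      refine ih.add ((AffineMap.lineMap_continuous.comp ?_).sub continuous_const)
      unfold coveredFraction
      fun_prop

theorem add_le_add_of_le {z w : ℝ × ℝ} (h : z ≤ w) : z.1 + z.2 ≤ w.1 + w.2 :=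
  add_le_add h.1 h.2

theorem eq_of_le_of_add_eq {z w : ℝ × ℝ} (h : z ≤ w) (h' : z.1 + z.2 = w.1 + w.2) : z = w := by
  have h1 := h.1
  have h2 := h.2
  ext <;> linarith

/-- `polyParam` adds up one clamped displacement per segment, each monotone in the parameter, so it
need not be determined which segment is current. -/
theorem monotone_polyParam {l : List (ℝ × ℝ)} (hl : l.IsChain (· ≤ ·)) :
    Monotone (polyParam l) := by
  induction l with
  | nil => exact monotone_const
  | cons z l ih =>
    cases l with
    | nil => exact monotone_const
    | cons w l =>
      rw [List.isChain_cons_cons] at hl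
      refine (ih hl.2).add fun s t hst => ?_
      refine sub_le_sub_right ?_ _
      have h : coveredFraction z w s ≤ coveredFraction z w t := by
        unfold coveredFraction
        have := sub_nonneg.2 (add_le_add_of_le hl.1)
        gcongr
      have h1 := hl.1.1
      have h2 := hl.1.2
      constructor <;> simp [AffineMap.lineMap_apply] <;> gcongr

theorem polyParam_of_le {z : ℝ × ℝ} {l : List (ℝ × ℝ)} (hl : (z :: l).IsChain (· ≤ ·)) {s : ℝ}
    (hs : s ≤ z.1 + z.2) : polyParam (z :: l) s = z := by
  induction l generalizing z with
  | nil => rfl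
  | cons w l ih =>
    rw [List.isChain_cons_cons] at hl
    have h := add_le_add_of_le hl.1
    have h0 : coveredFraction z w s = 0 :=
      max_eq_left ((min_le_right _ _).trans
        (div_nonpos_of_nonpos_of_nonneg (by linarith) (by linarith)))
    rw [polyParam, ih hl.2 (hs.trans h), h0]
    simp

theorem lineMap_coveredFraction_of_ge {z w : ℝ × ℝ} (hzw : z ≤ w) {s : ℝ}
    (hs : w.1 + w.2 ≤ s) : (AffineMap.lineMap z w (coveredFraction z w s) : ℝ × ℝ) = w := by
  -- For a degenerate segment the fraction is a division by zero, but its value is irrelevant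
  -- because the two endpoints coincide.
  rcases (add_le_add_of_le hzw).eq_or_lt with h | h
  · rw [eq_of_le_of_add_eq hzw h]; simp
  · have h0 : coveredFraction z w s = 1 := by
      rw [coveredFraction, min_eq_left, max_eq_right zero_le_one]
      rw [le_div_iff₀ (by linarith)]
      linarith
    rw [h0]; simp

theorem polyParam_cons_of_ge {z w : ℝ × ℝ} (hzw : z ≤ w) (l : List (ℝ × ℝ)) {s : ℝ}
    (hs : w.1 + w.2 ≤ s) : polyParam (z :: w :: l) s = polyParam (w :: l) s := by
  rw [polyParam, lineMap_coveredFraction_of_ge hzw hs, sub_self, add_zero]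

theorem polyParam_cons_of_le {z w : ℝ × ℝ} {l : List (ℝ × ℝ)}
    (hl : (w :: l).IsChain (· ≤ ·)) {s : ℝ} (hs : s ≤ w.1 + w.2) :
    polyParam (z :: w :: l) s = AffineMap.lineMap z w (coveredFraction z w s) := by
  rw [polyParam, polyParam_of_le hl hs, add_sub_cancel]

theorem head_le_getLast {z : ℝ × ℝ} {l : List (ℝ × ℝ)} (hl : (z :: l).IsChain (· ≤ ·)) :
    z ≤ (z :: l).getLast (List.cons_ne_nil _ _) := by
  induction l generalizing z with
  | nil => simp
  | cons w l ih =>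
    rw [List.isChain_cons_cons] at hl
    rw [List.getLast_cons_cons]
    exact hl.1.trans (ih hl.2)

theorem polyParam_getLast {z : ℝ × ℝ} {l : List (ℝ × ℝ)} (hl : (z :: l).IsChain (· ≤ ·)) {s : ℝ}
    (hs : ((z :: l).getLast (List.cons_ne_nil _ _)).1
      + ((z :: l).getLast (List.cons_ne_nil _ _)).2 ≤ s) :
    polyParam (z :: l) s = (z :: l).getLast (List.cons_ne_nil _ _) := by
  induction l generalizing z with
  | nil => rfl
  | cons w l ih =>
    rw [List.isChain_cons_cons] at hl
    simp only [List.getLast_cons_cons] at hs ⊢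
    rw [polyParam_cons_of_ge hl.1 _ ((add_le_add_of_le (head_le_getLast hl.2)).trans hs)]
    exact ih hl.2 hs

/-- The parameter can be recovered from the point; this makes the morphing built from the path
injective, even if vertices are repeated. -/
theorem polyParam_fst_add_snd {z : ℝ × ℝ} {l : List (ℝ × ℝ)} (hl : (z :: l).IsChain (· ≤ ·))
    {s : ℝ} (h0 : z.1 + z.2 ≤ s)
    (hs : s ≤ ((z :: l).getLast (List.cons_ne_nil _ _)).1
      + ((z :: l).getLast (List.cons_ne_nil _ _)).2) :
    (polyParam (z :: l) s).1 + (polyParam (z :: l) s).2 = s := by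
  induction l generalizing z with
  | nil => exact le_antisymm h0 hs
  | cons w l ih =>
    rw [List.isChain_cons_cons] at hl
    simp only [List.getLast_cons_cons] at hs
    rcases le_total (w.1 + w.2) s with h | h
    · rw [polyParam_cons_of_ge hl.1 _ h]
      exact ih hl.2 h hs
    · rw [polyParam_cons_of_le hl.2 h]
      rcases (h0.trans h).eq_or_lt with h' | h'
      · rw [eq_of_le_of_add_eq hl.1 h'] at h0 ⊢
        simp only [AffineMap.lineMap_same, AffineMap.const_apply]
        linarith
      · have hp : 0 < (w.1 + w.2) - (z.1 + z.2) := sub_pos.2 h'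
        have hc : coveredFraction z w s = (s - (z.1 + z.2)) / ((w.1 + w.2) - (z.1 + z.2)) := by
          rw [coveredFraction, min_eq_right ((div_le_one hp).2 (by linarith)),
            max_eq_right (div_nonneg (by linarith) hp.le)]
        have hm : coveredFraction z w s * ((w.1 + w.2) - (z.1 + z.2)) = s - (z.1 + z.2) := by
          rw [hc, div_mul_cancel₀ _ hp.ne']
        simp [AffineMap.lineMap_apply]
        linarith

theorem lineMap_eq_polyParam {z w : ℝ × ℝ} (hzw : z ≤ w) {l : List (ℝ × ℝ)}
    (hl : (w :: l).IsChain (· ≤ ·)) {t : ℝ} (ht : t ∈ Icc (0 : ℝ) 1) :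
    AffineMap.lineMap z w t
      = polyParam (z :: w :: l) ((z.1 + z.2) + t * ((w.1 + w.2) - (z.1 + z.2))) := by
  have h := sub_nonneg.2 (add_le_add_of_le hzw)
  rw [polyParam_cons_of_le hl (by nlinarith [ht.2])]
  rcases h.eq_or_lt with h' | h'
  · rw [eq_of_le_of_add_eq hzw (by linarith)]; simp
  · congr 1
    rw [coveredFraction, add_sub_cancel_left, mul_div_cancel_right₀ _ h'.ne', min_eq_right ht.2,
      max_eq_right ht.1]

theorem integral_leash_le_polyPrice {d : ℕ} {A B : PolyCurve d} (m : Morphing A B)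
    {z : ℝ × ℝ} {l : List (ℝ × ℝ)} (hl : (z :: l).IsChain (· ≤ ·))
    (hm : ∀ s, polyParam (z :: l) s ∈ Set.range m.path) :
    (∫ x in z.1..((z :: l).getLast (List.cons_ne_nil _ _)).1, leashLeft m x)
      + (∫ y in z.2..((z :: l).getLast (List.cons_ne_nil _ _)).2, leashRight m y)
      ≤ polyPrice A B (z :: l) := by
  induction l generalizing z with
  | nil => simp [polyPrice]
  | cons w l ih =>
    rw [List.isChain_cons_cons] at hl
    -- Before its own start the tail rests at `w`, a point that the whole path also visits.
    have hm' : ∀ s, polyParam (w :: l) s ∈ Set.range m.path := by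
      intro s
      rcases le_total (w.1 + w.2) s with h | h
      · rw [← polyParam_cons_of_ge hl.1 _ h]; exact hm s
      · rw [polyParam_of_le hl.2 h, ← polyParam_of_le hl.2 le_rfl,
          ← polyParam_cons_of_ge hl.1 l le_rfl]
        exact hm _
    have hseg : ∀ t ∈ Icc (0 : ℝ) 1, AffineMap.lineMap z w t ∈ Set.range m.path := fun t ht => by
      rw [lineMap_eq_polyParam hl.1 hl.2 ht]; exact hm _
    have h1 := integral_leashLeft_le m hl.1 hseg
    -- The leg on the second curve is the leg on the first after exchanging the curves.
    have h2 := integral_leashLeft_le m.swap (z := z.swap) (w := w.swap) ⟨hl.1.2, hl.1.1⟩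
      fun t ht => by
        have := (m.mem_range_swap _).2 (hseg t ht)
        convert this using 1
        ext <;> simp [AffineMap.lineMap_apply]
    have h3 := ih hl.2 hm'
    rw [legPrice_eq, meanElev_swap, ← legPrice_eq] at h2
    rw [← leashLeft_swap] at h3 ⊢
    simp only [List.getLast_cons_cons, polyPrice, segPrice, Prod.fst_swap] at h2 h3 ⊢
    rw [← intervalIntegral.integral_add_adjacent_intervals
      (intervalIntegrable_leashLeft m z.1 w.1) (intervalIntegrable_leashLeft m _ _),
      ← intervalIntegral.integral_add_adjacent_intervals
      (intervalIntegrable_leashLeft m.swap z.2 w.2) (intervalIntegrable_leashLeft m.swap _ _)]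
    linarith

theorem exists_morphing {d : ℕ} (A B : PolyCurve d) {z : ℝ × ℝ} {l : List (ℝ × ℝ)}
    (hl : (z :: l).IsChain (· ≤ ·)) (hz : z = (0, 0))
    (hlast : (z :: l).getLast (List.cons_ne_nil _ _) = (A.length, B.length)) :
    ∃ m : Morphing A B, m.IsMonotone ∧ warpingCost m ≤ polyPrice A B (z :: l) := by
  have hA := A.length_pos
  have hB := B.length_pos
  have hsum : ∀ s ∈ Icc 0 (A.length + B.length),
      (polyParam (z :: l) s).1 + (polyParam (z :: l) s).2 = s := fun s hs =>
    polyParam_fst_add_snd hl (by simpa [hz] using hs.1) (by simpa [hlast] using hs.2)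
  have hmono := monotone_polyParam hl
  have hle : ∀ s ≤ 0, polyParam (z :: l) s = (0, 0) := fun s hs =>
    (polyParam_of_le hl (by simpa [hz] using hs)).trans hz
  have hge : ∀ s, A.length + B.length ≤ s → polyParam (z :: l) s = (A.length, B.length) :=
    fun s hs => (polyParam_getLast hl (by simpa [hlast] using hs)).trans hlast
  have hbd : ∀ s, polyParam (z :: l) s ∈ Icc (0 : ℝ) A.length ×ˢ Icc (0 : ℝ) B.length := by
    intro s
    have h1 : ((0 : ℝ), (0 : ℝ)) ≤ polyParam (z :: l) s := by
      rw [← hle (min s 0) (min_le_right _ _)]; exact hmono (min_le_left _ _)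
    have h2 : polyParam (z :: l) s ≤ (A.length, B.length) := by
      rw [← hge (max s (A.length + B.length)) (le_max_right _ _)]; exact hmono (le_max_left _ _)
    exact ⟨⟨h1.1, h2.1⟩, ⟨h1.2, h2.2⟩⟩
  have hmem : ∀ t : unitInterval, (t : ℝ) * (A.length + B.length) ∈ Icc 0 (A.length + B.length) :=
    fun t => ⟨mul_nonneg t.2.1 (by linarith), mul_le_of_le_one_left (by linarith) t.2.2⟩
  let m : Morphing A B :=
    { path :=
        { toFun := fun t => polyParam (z :: l) (t * (A.length + B.length))
          continuous_toFun := (continuous_polyParam _).comp (by fun_prop)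
          source' := by simpa using hle 0 le_rfl
          target' := by simpa using hge _ le_rfl }
      injective := by
        intro s t h
        change polyParam (z :: l) _ = polyParam (z :: l) _ at h
        have h1 := hsum _ (hmem s)
        rw [h, hsum _ (hmem t)] at h1
        exact Subtype.ext (mul_right_cancel₀ (by linarith) h1).symm
      mem_diagram := fun t => hbd _ }
  have hrange : ∀ s, polyParam (z :: l) s ∈ Set.range m.path := by
    intro s
    rcases le_total s 0 with h | h
    · exact ⟨0, by rw [hle s h]; exact m.path.source⟩
    rcases le_total (A.length + B.length) s with h' | h'
    · exact ⟨1, by rw [hge s h']; exact m.path.target⟩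
    refine ⟨⟨s / (A.length + B.length), div_nonneg h (by linarith),
      (div_le_one (by linarith)).2 h'⟩, ?_⟩
    change polyParam (z :: l) (s / (A.length + B.length) * (A.length + B.length)) = _
    rw [div_mul_cancel₀]
    linarith
  refine ⟨m, fun s t hst => hmono ?_, ?_⟩
  · have : (s : ℝ) ≤ t := hst
    gcongr
  · have := integral_leash_le_polyPrice m hl hrange
    rw [hlast] at this
    simpa [hz, warpingCost] using this

theorem cdtw_le_polyPrice {d : ℕ} (A B : PolyCurve d) {z : ℝ × ℝ} {l : List (ℝ × ℝ)}
    (hl : (z :: l).IsChain (· ≤ ·)) (hz : z = (0, 0))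
    (hlast : (z :: l).getLast (List.cons_ne_nil _ _) = (A.length, B.length)) :
    cdtw A B ≤ polyPrice A B (z :: l) := by
  obtain ⟨m, hm, h⟩ := exists_morphing A B hl hz hlast
  exact (cdtw_le_warpingCost hm).trans h

theorem exists_warpingCost_lt {d : ℕ} (A B : PolyCurve d) {c : ℝ} (hc : cdtw A B < c) :
    ∃ m : Morphing A B, m.IsMonotone ∧ warpingCost m < c := by
  -- The diagonal of the diagram shows that the infimum is over a nonempty set.
  obtain ⟨m, hm, -⟩ := exists_morphing A B (z := (0, 0)) (l := [(A.length, B.length)])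
    (by simp [A.length_nonneg, B.length_nonneg]) rfl rfl
  obtain ⟨_, ⟨m', hm', rfl⟩, h⟩ := exists_lt_of_csInf_lt
    (s := {c | ∃ m : Morphing A B, m.IsMonotone ∧ c = warpingCost m}) ⟨_, m, hm, rfl⟩ hc
  exact ⟨m', hm', h⟩

/-! ### Refinement, splitting and mesh size -/

namespace PolyCurve

theorem exists_edge {d : ℕ} (C : PolyCurve d) {x : ℝ} (hx : x ∈ Icc 0 C.length) :
    ∃ k < C.n, x ∈ Icc (C.arc k) (C.arc (k + 1)) := by
  have key : ∀ N, x ∈ Icc 0 (C.arc (N + 1)) → ∃ k ≤ N, x ∈ Icc (C.arc k) (C.arc (k + 1)) := by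
    intro N
    induction N with
    | zero => intro h; exact ⟨0, le_rfl, by simpa [arc_zero] using h⟩
    | succ N ih =>
      intro h
      rcases le_total x (C.arc (N + 1)) with h' | h'
      · obtain ⟨k, hk, hx⟩ := ih ⟨h.1, h'⟩
        exact ⟨k, by omega, hx⟩
      · exact ⟨N + 1, le_rfl, h', h.2⟩
  have hn := C.n_pos
  obtain ⟨k, hk, h⟩ := key (C.n - 1) (by rwa [Nat.sub_add_cancel hn])
  exact ⟨k, by omega, h⟩

/-- `C'` is obtained from `C` by inserting vertices. -/
structure Refines (C C' : PolyCurve d) : Prop where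
  length_eq : C'.length = C.length
  param_eq_on : ∀ x ∈ Icc 0 C.length, C'.param x = C.param x
  breaks_subset : C.breaks ⊆ C'.breaks

theorem Refines.refl {d : ℕ} (C : PolyCurve d) : Refines C C := ⟨rfl, fun _ _ => rfl, Subset.rfl⟩

theorem Refines.trans {d : ℕ} {C C' C'' : PolyCurve d} (h : Refines C C') (h' : Refines C' C'') :
    Refines C C'' :=
  ⟨h'.length_eq.trans h.length_eq,
    fun x hx => (h'.param_eq_on x (by rwa [h.length_eq])).trans (h.param_eq_on x hx),
    h.breaks_subset.trans h'.breaks_subset⟩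

theorem Refines.param_eq {d : ℕ} {C C' : PolyCurve d} (h : Refines C C') :
    C'.param = C.param := by
  funext x
  rw [← C'.param_clamp, ← C.param_clamp, h.length_eq]
  exact h.param_eq_on _ ⟨le_max_left _ _, max_le C.length_nonneg (min_le_left _ _)⟩

/-- All edges of `C` have length at most `δ`. -/
def MeshLE (C : PolyCurve d) (δ : ℝ) : Prop := ∀ k < C.n, C.edgeLen k ≤ δ

theorem exists_meshLE {d : ℕ} (C : PolyCurve d) : ∃ M, 0 ≤ M ∧ C.MeshLE M := by
  refine ⟨C.length, C.length_nonneg, fun k hk => ?_⟩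
  have h := C.arc_le_length (k := k + 1) hk
  have := C.arc_nonneg k
  rw [arc_succ] at h
  linarith

theorem MeshLE.nonneg {d : ℕ} {C : PolyCurve d} {δ : ℝ} (h : C.MeshLE δ) : 0 ≤ δ :=
  (C.edgeLen_nonneg 0).trans (h 0 C.n_pos)

/-- Vertices of `C` remain vertices of `C'`, so no edge of `C'` has a vertex of `C` in its interior,
and it lies within a single edge of `C`. -/
theorem MeshLE.of_refines {d : ℕ} {C C' : PolyCurve d} {δ : ℝ} (h : C.MeshLE δ)
    (hr : Refines C C') : C'.MeshLE δ := by
  intro k hk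
  have h1 := C'.arc_lt_arc_succ hk
  have h2 := C'.arc_le_length (k := k + 1) hk
  rw [hr.length_eq] at h2
  obtain ⟨K, hK, hx⟩ := C.exists_edge (x := C'.arc (k + 1)) ⟨C'.arc_nonneg _, h2⟩
  have : C.arc K ≤ C'.arc k ∨ C.arc K = C'.arc (k + 1) := by
    obtain ⟨j, -, hj⟩ := hr.breaks_subset ⟨K, hK.le, rfl⟩
    rcases Nat.lt_or_ge k j with hkj | hkj
    · exact Or.inr (le_antisymm hx.1 (hj ▸ C'.arc_mono hkj))
    · exact Or.inl (hj ▸ C'.arc_mono hkj)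
  rcases this with hl | hl
  · have := h K hK
    have := hx.2
    rw [arc_succ] at h1 hx this
    rw [arc_succ] at this
    linarith
  -- The edge found begins where the edge of `C'` ends; the preceding edge of `C` is the one that
  -- contains it.
  · obtain ⟨J, rfl⟩ : ∃ J, K = J + 1 := by
      refine Nat.exists_eq_succ_of_ne_zero ?_
      rintro rfl
      rw [C.arc_zero] at hl
      linarith [C'.arc_nonneg k]
    have hJ : C.arc J ≤ C'.arc k := by
      obtain ⟨j, -, hj⟩ := hr.breaks_subset ⟨J, by omega, rfl⟩
      rcases Nat.lt_or_ge k j with hkj | hkj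
      · have h3 := C'.arc_mono hkj
        have h4 := C.arc_lt_arc_succ (k := J) (by omega)
        simp only [Nat.succ_eq_add_one] at h3
        linarith
      · exact hj ▸ C'.arc_mono hkj
    have := h J (by omega)
    rw [arc_succ] at hl
    have h5 := C'.arc_succ k
    linarith

theorem split_edgeLen {d : ℕ} (C : PolyCurve d) (k : ℕ) :
    C.split.edgeLen k = C.edgeLen (k / 2) / 2 := by
  rcases Nat.mod_two_eq_zero_or_one k with h | h
  · have h1 : (k + 1) % 2 ≠ 0 := by omega
    have h2 : (k + 1) / 2 = k / 2 := by omega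
    simp only [edgeLen, split, if_pos h, if_neg h1, h2]
    rw [dist_left_midpoint (𝕜 := ℝ)]
    norm_num
    ring
  · have h0 : k % 2 ≠ 0 := by omega
    have h1 : (k + 1) % 2 = 0 := by omega
    have h2 : (k + 1) / 2 = k / 2 + 1 := by omega
    simp only [edgeLen, split, if_neg h0, if_pos h1, h2]
    rw [dist_midpoint_right (𝕜 := ℝ)]
    norm_num
    ring

theorem split_arc {d : ℕ} (C : PolyCurve d) (k : ℕ) : C.split.arc (2 * k) = C.arc k := by
  induction k with
  | zero => simp [arc_zero]
  | succ k ih =>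
    have h1 : 2 * k / 2 = k := by omega
    have h2 : (2 * k + 1) / 2 = k := by omega
    rw [show 2 * (k + 1) = 2 * k + 1 + 1 by ring, arc_succ, arc_succ, ih, arc_succ, split_edgeLen,
      split_edgeLen, h1, h2]
    ring

theorem split_vtx {d : ℕ} (C : PolyCurve d) (k : ℕ) : C.split.vtx (2 * k) = C.vtx k := by
  simp [split]

theorem split_vtx_succ {d : ℕ} (C : PolyCurve d) (k : ℕ) :
    C.split.vtx (2 * k + 1) = midpoint ℝ (C.vtx k) (C.vtx (k + 1)) := by
  have h1 : (2 * k + 1) % 2 ≠ 0 := by omega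
  have h2 : (2 * k + 1) / 2 = k := by omega
  simp only [split, if_neg h1, h2]

theorem midpoint_eq {d : ℕ} (C : PolyCurve d) {k : ℕ} (hk : k < C.n) :
    midpoint ℝ (C.vtx k) (C.vtx (k + 1)) = C.vtx k + (C.edgeLen k / 2) • C.dir k := by
  rw [div_eq_inv_mul, mul_smul, C.edgeLen_smul_dir hk, midpoint_eq_smul_add, smul_sub, smul_add]
  have : C.vtx k = (2⁻¹ : ℝ) • C.vtx k + (2⁻¹ : ℝ) • C.vtx k := by
    rw [← add_smul]; norm_num
  rw [invOf_eq_inv]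
  nth_rw 2 [this]
  abel

theorem split_dir {d : ℕ} (C : PolyCurve d) {k : ℕ} (hk : k < C.n) :
    C.split.dir (2 * k) = C.dir k ∧ C.split.dir (2 * k + 1) = C.dir k := by
  have h1 : 2 * k / 2 = k := by omega
  have h2 : (2 * k + 1) / 2 = k := by omega
  have h3 := C.edgeLen_pos hk
  have h4 : C.vtx (k + 1) = C.vtx k + C.edgeLen k • C.dir k := by
    rw [C.edgeLen_smul_dir hk]; abel
  constructor
  · rw [dir, split_edgeLen, h1, split_vtx, split_vtx_succ, C.midpoint_eq hk, add_sub_cancel_left,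
      inv_smul_smul₀ (by positivity)]
  · rw [dir, split_edgeLen, h2, split_vtx_succ, show 2 * k + 1 + 1 = 2 * (k + 1) by ring,
      split_vtx, C.midpoint_eq hk, inv_smul_eq_iff₀ (by positivity), h4]
    rw [add_sub_add_left_eq_sub, ← sub_smul]
    congr 1
    ring

theorem refines_split {d : ℕ} (C : PolyCurve d) : Refines C C.split := by
  refine ⟨C.split_arc C.n, fun x hx => ?_, ?_⟩
  · obtain ⟨k, hk, h⟩ := C.exists_edge hx
    have h1 : 2 * k / 2 = k := by omega
    have ha : C.split.arc (2 * k + 1) = C.arc k + C.edgeLen k / 2 := by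
      rw [arc_succ, split_arc, split_edgeLen, h1]
    have hn : C.split.n = 2 * C.n := rfl
    rw [C.param_eq hk h]
    rcases le_total x (C.split.arc (2 * k + 1)) with hle | hle
    · rw [C.split.param_eq (k := 2 * k) (by omega) ⟨by rw [split_arc]; exact h.1, hle⟩,
        split_vtx, split_arc, (C.split_dir hk).1]
    · rw [C.split.param_eq (k := 2 * k + 1) (by omega)
        ⟨hle, by rw [show 2 * k + 1 + 1 = 2 * (k + 1) by ring, split_arc]; exact h.2⟩,
        split_vtx_succ, (C.split_dir hk).2, C.midpoint_eq hk, ha, add_assoc, ← add_smul]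
      congr 2
      ring
  · rintro _ ⟨k, hk, rfl⟩
    exact ⟨2 * k, Nat.mul_le_mul_left 2 hk, (C.split_arc k).symm⟩

theorem MeshLE.split {d : ℕ} {C : PolyCurve d} {δ : ℝ} (h : C.MeshLE δ) :
    C.split.MeshLE (δ / 2) := by
  intro k hk
  have hn : C.split.n = 2 * C.n := rfl
  rw [split_edgeLen]
  have := h (k / 2) (by omega)
  gcongr

theorem refines_split_iterate {d : ℕ} (C : PolyCurve d) (i : ℕ) :
    Refines C (PolyCurve.split^[i] C) := by
  induction i with
  | zero => exact Refines.refl C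
  | succ i ih =>
    rw [Function.iterate_succ_apply']
    exact ih.trans (refines_split _)

theorem MeshLE.split_iterate {d : ℕ} {C : PolyCurve d} {δ : ℝ} (h : C.MeshLE δ) (i : ℕ) :
    (PolyCurve.split^[i] C).MeshLE (δ / 2 ^ i) := by
  induction i with
  | zero => simpa using h
  | succ i ih =>
    rw [Function.iterate_succ_apply', pow_succ, ← div_div]
    exact ih.split

end PolyCurve

theorem elev_eq_of_refines {d : ℕ} {A B A' B' : PolyCurve d} (hA : A.Refines A')
    (hB : B.Refines B') : elev A' B' = elev A B := by
  funext z
  rw [elev, elev, hA.param_eq, hB.param_eq]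

theorem SweepRun.refines {d : ℕ} {A B : PolyCurve d} (R : SweepRun A B) :
    A.Refines R.A' ∧ B.Refines R.B' := by
  have key : ∀ P : PolyCurve d × PolyCurve d, Relation.ReflTransGen BisectionRound (A, B) P →
      A.Refines P.1 ∧ B.Refines P.2 := by
    intro P h
    induction h with
    | refl => exact ⟨.refl A, .refl B⟩
    | tail _ h ih =>
      obtain ⟨γ, -, -, h1, h2⟩ := h
      exact ⟨ih.1.trans ⟨h1.1, h1.2.1, h1.2.2.symm ▸ subset_union_left⟩,
        ih.2.trans ⟨h2.1, h2.2.1, h2.2.2.symm ▸ subset_union_left⟩⟩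
  exact key _ R.rounds

/-! ### Portals and paths of the VE graph -/

namespace VENode

/-- The column of the grid edge. -/
def col : VENode → ℕ
  | vert i _ => i
  | horiz i _ => i

/-- The row of the grid edge. -/
def row : VENode → ℕ
  | vert _ j => j
  | horiz _ j => j

/-- The grid edge with the roles of the two curves exchanged. -/
def swap : VENode → VENode
  | vert i j => horiz j i
  | horiz i j => vert j i

/-- The grid edge lies in the free space diagram. -/
def IsValid {d : ℕ} (A B : PolyCurve d) : VENode → Prop
  | vert i j => i ≤ A.n ∧ j < B.n
  | horiz i j => i < A.n ∧ j ≤ B.n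

theorem finite_isValid {d : ℕ} (A B : PolyCurve d) : {u | IsValid A B u}.Finite := by
  refine (((Set.finite_Iic A.n).prod (Set.finite_Iic B.n)).image (fun p => vert p.1 p.2) |>.union
    (((Set.finite_Iic A.n).prod (Set.finite_Iic B.n)).image (fun p => horiz p.1 p.2))).subset ?_
  rintro (⟨i, j⟩ | ⟨i, j⟩) ⟨h1, h2⟩
  · exact Or.inl ⟨(i, j), ⟨h1, h2.le⟩, rfl⟩
  · exact Or.inr ⟨(i, j), ⟨h1.le, h2⟩, rfl⟩

end VENode

theorem loc_swap {d : ℕ} (A B : PolyCurve d) (u : VENode) :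
    loc B A u.swap = (loc A B u).swap := by
  rcases u with ⟨i, j⟩ | ⟨i, j⟩ <;> simp only [VENode.swap, loc, and_comm] <;> split_ifs <;> rfl

theorem veAdj_swap {d : ℕ} {A B : PolyCurve d} {u v : VENode} (h : VEAdj A B u v) :
    VEAdj B A u.swap v.swap := by
  obtain ⟨i, hi, j, hj, rfl | rfl, rfl | rfl⟩ := h <;>
    exact ⟨j, hj, i, hi, by simp [VENode.swap], by simp [VENode.swap]⟩

/-- A portal moved to a corner of the diagram stays on its grid edge, because that corner is an
endpoint of the edge. -/
theorem loc_vert {d : ℕ} (A B : PolyCurve d) (i j : ℕ) :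
    (loc A B (.vert i j)).1 = A.arc i ∧ (loc A B (.vert i j)).2 ∈ Icc (B.arc j) (B.arc (j + 1)) := by
  have hj := B.arc_mono j.le_succ
  simp only [loc]
  split_ifs with h1 h2
  · obtain ⟨rfl, rfl⟩ := h1
    exact ⟨A.arc_zero.symm, by rw [B.arc_zero], B.arc_nonneg _⟩
  · obtain ⟨rfl, h⟩ := h2
    refine ⟨rfl, ?_⟩
    change B.length ∈ _
    rw [PolyCurve.length, ← h]
    exact ⟨hj, le_rfl⟩
  · exact ⟨rfl, B.footParam_mem _ _⟩

theorem loc_horiz {d : ℕ} (A B : PolyCurve d) (i j : ℕ) :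
    (loc A B (.horiz i j)).1 ∈ Icc (A.arc i) (A.arc (i + 1)) ∧ (loc A B (.horiz i j)).2 = B.arc j := by
  have h := loc_vert B A j i
  have e := loc_swap B A (.vert j i)
  rw [VENode.swap] at e
  rw [e]
  exact ⟨h.2, h.1⟩

theorem loc_fst_bounds {d : ℕ} {A B : PolyCurve d} {δ : ℝ} (hA : A.MeshLE δ) {u : VENode}
    (hu : u.IsValid A B) : (loc A B u).1 ∈ Icc (A.arc u.col) (A.arc u.col + δ) ∧
      (loc A B u).1 ≤ A.length := by
  rcases u with ⟨i, j⟩ | ⟨i, j⟩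
  · have h := (loc_vert A B i j).1
    have := hA.nonneg
    rw [h, VENode.col]
    exact ⟨⟨le_rfl, by linarith⟩, A.arc_le_length hu.1⟩
  · have h := (loc_horiz A B i j).1
    refine ⟨⟨h.1, h.2.trans ?_⟩, h.2.trans (A.arc_le_length hu.1)⟩
    rw [A.arc_succ]
    have := hA i hu.1
    simp only [VENode.col]
    gcongr

theorem loc_snd_bounds {d : ℕ} {A B : PolyCurve d} {δ : ℝ} (hB : B.MeshLE δ) {u : VENode}
    (hu : u.IsValid A B) : (loc A B u).2 ∈ Icc (B.arc u.row) (B.arc u.row + δ) ∧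
      (loc A B u).2 ≤ B.length := by
  have hu' : u.swap.IsValid B A := by
    rcases u with ⟨i, j⟩ | ⟨i, j⟩ <;> exact ⟨hu.2, hu.1⟩
  have hr : u.swap.col = u.row := by cases u <;> rfl
  have h := loc_fst_bounds hB hu'
  rwa [loc_swap, hr, Prod.fst_swap] at h

theorem loc_of_isStart {d : ℕ} (A B : PolyCurve d) {u : VENode} (h : IsStart u) :
    loc A B u = (0, 0) := by
  rcases h with rfl | rfl <;> simp [loc]

theorem loc_of_isTarget {d : ℕ} {A B : PolyCurve d} {u : VENode} (h : IsTarget A B u) :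
    loc A B u = (A.length, B.length) := by
  have hA := A.n_pos
  have hB := B.n_pos
  rcases h with rfl | rfl
  · simp [loc, hA.ne', Nat.sub_add_cancel hB]
  · simp [loc, hB.ne', Nat.sub_add_cancel hA]

/-- The grid edges are valid, and neither column nor row decreases. -/
structure VEBefore {d : ℕ} (A B : PolyCurve d) (u v : VENode) : Prop where
  valid_left : u.IsValid A B
  valid_right : v.IsValid A B
  col_le : u.col ≤ v.col
  row_le : u.row ≤ v.row
  lt : u.col + u.row < v.col + v.row

instance {d : ℕ} (A B : PolyCurve d) : IsTrans VENode (VEBefore A B) :=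
  ⟨fun _ _ _ h h' => ⟨h.1, h'.2, h.3.trans h'.3, h.4.trans h'.4, h.5.trans h'.5⟩⟩

theorem VEAdj.before {d : ℕ} {A B : PolyCurve d} {u v : VENode} (h : VEAdj A B u v) :
    VEBefore A B u v := by
  obtain ⟨i, hi, j, hj, rfl | rfl, rfl | rfl⟩ := h <;> constructor <;>
    simp only [VENode.IsValid, VENode.col, VENode.row] <;> omega

theorem IsVEPath.pairwise {d : ℕ} {A B : PolyCurve d} {γ : List VENode} (h : IsVEPath A B γ) :
    γ.Pairwise (VEBefore A B) :=
  List.isChain_iff_pairwise.1 (h.chain.imp fun _ _ => VEAdj.before)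

theorem IsVEPath.valid {d : ℕ} {A B : PolyCurve d} {γ : List VENode} (h : IsVEPath A B γ) :
    ∀ u ∈ γ, u.IsValid A B := by
  have hp := h.pairwise
  obtain ⟨s, hs, hs'⟩ := h.start
  cases γ with
  | nil => simp
  | cons u l =>
    rw [List.pairwise_cons] at hp
    rw [List.forall_mem_cons]
    refine ⟨?_, fun v hv => (hp.1 v hv).2⟩
    simp only [List.head?_cons, Option.mem_def, Option.some.injEq] at hs
    subst hs
    have := A.n_pos
    have := B.n_pos
    rcases hs' with rfl | rfl <;> simp only [VENode.IsValid] <;> omega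

theorem IsVEPath.nodup {d : ℕ} {A B : PolyCurve d} {γ : List VENode} (h : IsVEPath A B γ) :
    γ.Nodup :=
  h.pairwise.imp fun h e => h.lt.ne (by rw [e])

/-- The sum of column and row strictly increases along a path, so a path is a list without
repetitions over the finite set of grid edges. A cheapest path therefore exists once there is any
path. -/
theorem finite_isVEPath {d : ℕ} (A B : PolyCurve d) : {γ | IsVEPath A B γ}.Finite := by
  classical
  have := (VENode.finite_isValid A B).fintype
  refine (Set.finite_range (fun l : {l : List {u | VENode.IsValid A B u} // l.Nodup} =>
    l.1.map Subtype.val)).subset fun γ hγ => ?_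
  have hv := hγ.valid
  have hn := hγ.nodup
  lift γ to List {u | VENode.IsValid A B u} using hv
  exact ⟨⟨γ, hn.of_map _⟩, rfl⟩

theorem exists_isShortestVEPath {d : ℕ} {A B : PolyCurve d} (h : ∃ γ, IsVEPath A B γ) :
    ∃ γ, IsShortestVEPath A B γ :=
  Set.exists_min_image _ _ (finite_isVEPath A B) h

theorem IsVEPath.exists_eq_cons {d : ℕ} {A B : PolyCurve d} {γ : List VENode}
    (h : IsVEPath A B γ) : ∃ l, trace A B γ = (0, 0) :: l ∧
      ((0, 0) :: l).getLast (List.cons_ne_nil _ _) = (A.length, B.length) := by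
  obtain ⟨s, hs, hs'⟩ := h.start
  obtain ⟨t, ht, ht'⟩ := h.target
  cases γ with
  | nil => simp at hs
  | cons u l =>
    simp only [List.head?_cons, Option.mem_def, Option.some.injEq] at hs
    subst hs
    have e : trace A B (u :: l) = (0, 0) :: l.map (loc A B) := by
      rw [trace, List.map_cons, loc_of_isStart A B hs']
    refine ⟨l.map (loc A B), e, ?_⟩
    rw [List.getLast_eq_iff_getLast?_eq_some, ← e, trace, List.getLast?_map,
      Option.mem_def.1 ht, Option.map_some, loc_of_isTarget ht']

theorem IsVEPath.le_of_mem_trace {d : ℕ} {A B : PolyCurve d} {γ : List VENode}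
    (h : IsVEPath A B γ) : ∀ z ∈ trace A B γ, z ≤ (A.length, B.length) := by
  obtain ⟨_, -, hA⟩ := A.exists_meshLE
  obtain ⟨_, -, hB⟩ := B.exists_meshLE
  intro z hz
  obtain ⟨u, hu, rfl⟩ := List.mem_map.1 hz
  exact ⟨(loc_fst_bounds hA (h.valid u hu)).2, (loc_snd_bounds hB (h.valid u hu)).2⟩

/-- Columns and rows never decrease, and a portal lies at most δ beyond the start of its column and
row. The bound thus holds for any two vertices of the path, however far apart. -/
theorem IsVEPath.pairwise_trace {d : ℕ} {A B : PolyCurve d} {γ : List VENode}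
    (h : IsVEPath A B γ) {δ : ℝ} (hA : A.MeshLE δ) (hB : B.MeshLE δ) :
    (trace A B γ).Pairwise fun z w => z.1 ≤ w.1 + δ ∧ z.2 ≤ w.2 + δ := by
  rw [trace, List.pairwise_map]
  refine h.pairwise.imp fun {u v} huv => ?_
  have h1 := (loc_fst_bounds hA huv.1).1.2
  have h2 := (loc_fst_bounds hA huv.2).1.1
  have h3 := (loc_snd_bounds hB huv.1).1.2
  have h4 := (loc_snd_bounds hB huv.2).1.1
  have h5 := A.arc_mono huv.3
  have h6 := B.arc_mono huv.4
  constructor <;> linarith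

/-! ### Cost of monotonizing a path -/

/-- This turns the running maximum into an accumulator `p`, the form in which the following
inductions run. -/
theorem map_sup_monotonize_cons (p w : ℝ × ℝ) (l : List (ℝ × ℝ)) :
    (monotonize (w :: l)).map (fun v => p ⊔ v)
      = (p ⊔ w) :: (monotonize l).map (fun v => (p ⊔ w) ⊔ v) := by
  simp [monotonize, sup_assoc]

theorem isChain_cons_map_sup_monotonize (p : ℝ × ℝ) (l : List (ℝ × ℝ)) :
    (p :: (monotonize l).map (fun v => p ⊔ v)).IsChain (· ≤ ·) := by
  induction l generalizing p with
  | nil => simp [monotonize]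
  | cons w l ih =>
    rw [map_sup_monotonize_cons, List.isChain_cons_cons]
    exact ⟨le_sup_left, ih _⟩

theorem getLast_cons_map_sup_monotonize {p z T : ℝ × ℝ} {l : List (ℝ × ℝ)} (hz : z ≤ p)
    (hp : p ≤ T) (hl : ∀ w ∈ l, w ≤ T) (hT : (z :: l).getLast (List.cons_ne_nil _ _) = T) :
    (p :: (monotonize l).map (fun v => p ⊔ v)).getLast (List.cons_ne_nil _ _) = T := by
  induction l generalizing p z with
  | nil => exact le_antisymm hp (hT ▸ hz)
  | cons w l ih =>
    rw [List.forall_mem_cons] at hl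
    simp only [map_sup_monotonize_cons, List.getLast_cons_cons] at hT ⊢
    exact ih le_sup_right (sup_le hp hl.1) hl.2 hT

/-- Here `p` is the running maximum at the current vertex `z`. Passing to running maxima raises the
mean elevation of a segment by at most 2δ and does not increase its displacement in either
coordinate. The error, 2δ times the displacement of the monotone path, telescopes. -/
theorem polyPrice_cons_map_sup_monotonize_le {d : ℕ} (A B : PolyCurve d) {δ : ℝ}
    {p z T : ℝ × ℝ} {l : List (ℝ × ℝ)} (hz : z ≤ p) (hz1 : p.1 ≤ z.1 + δ) (hz2 : p.2 ≤ z.2 + δ)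
    (hpT : p ≤ T) (hT : ∀ w ∈ l, w ≤ T) (hp : ∀ w ∈ l, p.1 ≤ w.1 + δ ∧ p.2 ≤ w.2 + δ)
    (hl : l.Pairwise fun z w => z.1 ≤ w.1 + δ ∧ z.2 ≤ w.2 + δ) :
    polyPrice A B (p :: (monotonize l).map (fun v => p ⊔ v))
      ≤ polyPrice A B (z :: l) + 2 * δ * ((T.1 - p.1) + (T.2 - p.2)) := by
  have hδ : 0 ≤ δ := by linarith [hz.1]
  induction l generalizing p z with
  | nil =>
    have h1 := sub_nonneg.2 hpT.1
    have h2 := sub_nonneg.2 hpT.2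
    simp only [monotonize, List.map_nil, polyPrice, zero_add]
    positivity
  | cons w l ih =>
    rw [List.forall_mem_cons] at hT hp
    rw [List.pairwise_cons] at hl
    have hs1 : (p ⊔ w).1 = max p.1 w.1 := rfl
    have hs2 : (p ⊔ w).2 = max p.2 w.2 := rfl
    have hw1 : (p ⊔ w).1 ≤ w.1 + δ := max_le hp.1.1 (by linarith)
    have hw2 : (p ⊔ w).2 ≤ w.2 + δ := max_le hp.1.2 (by linarith)
    have ih' := ih (p := p ⊔ w) (z := w) le_sup_right hw1 hw2 (sup_le hpT hT.1) hT.2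
      (fun v hv => ⟨max_le (hp.2 v hv).1 (hl.1 v hv).1, max_le (hp.2 v hv).2 (hl.1 v hv).2⟩) hl.2
    have hpw1 : p.1 ≤ (p ⊔ w).1 := le_max_left _ _
    have hpw2 : p.2 ≤ (p ⊔ w).2 := le_max_left _ _
    have hww1 : w.1 ≤ (p ⊔ w).1 := le_max_right _ _
    have hww2 : w.2 ≤ (p ⊔ w).2 := le_max_right _ _
    have hm : meanElev A B p (p ⊔ w) ≤ meanElev A B z w + δ + δ := by
      apply meanElev_le_add
      · rw [abs_of_nonneg (sub_nonneg.2 hz.1)]; linarith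
      · rw [abs_of_nonneg (sub_nonneg.2 hww1)]; linarith
      · rw [abs_of_nonneg (sub_nonneg.2 hz.2)]; linarith
      · rw [abs_of_nonneg (sub_nonneg.2 hww2)]; linarith
    have hd1 : (p ⊔ w).1 - p.1 ≤ |w.1 - z.1| := by
      rw [hs1, sub_le_iff_le_add]
      exact max_le (by linarith [abs_nonneg (w.1 - z.1)]) (by linarith [le_abs_self (w.1 - z.1), hz.1])
    have hd2 : (p ⊔ w).2 - p.2 ≤ |w.2 - z.2| := by
      rw [hs2, sub_le_iff_le_add]
      exact max_le (by linarith [abs_nonneg (w.2 - z.2)]) (by linarith [le_abs_self (w.2 - z.2), hz.2])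
    have hseg : segPrice A B p (p ⊔ w) ≤ segPrice A B z w
        + 2 * δ * (((p ⊔ w).1 - p.1) + ((p ⊔ w).2 - p.2)) := by
      rw [segPrice_eq, segPrice_eq, abs_of_nonneg (sub_nonneg.2 hpw1),
        abs_of_nonneg (sub_nonneg.2 hpw2)]
      have h0 := meanElev_nonneg A B z w
      have h1 : 0 ≤ ((p ⊔ w).1 - p.1) + ((p ⊔ w).2 - p.2) := by linarith
      have h2 := mul_le_mul_of_nonneg_left hm h1
      have h3 := mul_le_mul_of_nonneg_right (add_le_add hd1 hd2) h0
      linarith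
    rw [map_sup_monotonize_cons, polyPrice, polyPrice]
    linarith

theorem IsVEPath.cdtw_le {d : ℕ} {A₀ B₀ A B : PolyCurve d} (hA : A₀.Refines A)
    (hB : B₀.Refines B) {γ : List VENode} (h : IsVEPath A B γ) :
    cdtw A₀ B₀ ≤ polyPrice A B (monotonize (trace A B γ)) := by
  obtain ⟨l, hl, hlast⟩ := h.exists_eq_cons
  have hT := h.le_of_mem_trace
  rw [hl, List.forall_mem_cons] at hT
  rw [hA.length_eq, hB.length_eq] at hlast hT
  rw [hl, monotonize, polyPrice_congr (elev_eq_of_refines hA hB)]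
  exact cdtw_le_polyPrice A₀ B₀ (isChain_cons_map_sup_monotonize _ _) rfl
    (getLast_cons_map_sup_monotonize le_rfl hT.1 hT.2 hlast)

theorem IsVEPath.polyPrice_monotonize_le {d : ℕ} {A B : PolyCurve d} {γ : List VENode}
    (h : IsVEPath A B γ) {δ : ℝ} (hA : A.MeshLE δ) (hB : B.MeshLE δ) :
    polyPrice A B (monotonize (trace A B γ))
      ≤ polyPrice A B (trace A B γ) + 2 * δ * (A.length + B.length) := by
  obtain ⟨l, hl, hlast⟩ := h.exists_eq_cons
  have hT := h.le_of_mem_trace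
  have hp := h.pairwise_trace hA hB
  rw [hl, List.forall_mem_cons] at hT
  rw [hl, List.pairwise_cons] at hp
  rw [hl, monotonize]
  simpa using polyPrice_cons_map_sup_monotonize_le A B le_rfl (by simpa using hA.nonneg)
    (by simpa using hA.nonneg) hT.1 hT.2 hp.1 hp.2

/-! ### Total variation of feet on a short edge -/

theorem eVariationOn_neg {α : Type*} [LinearOrder α] (f : α → ℝ) (s : Set α) :
    eVariationOn (fun x => -f x) s = eVariationOn f s := by
  simp only [eVariationOn, edist_neg_neg]

theorem eVariationOn_Icc_le_of_monotoneOn_or_antitoneOn {f : ℝ → ℝ} {a b δ : ℝ} (hab : a ≤ b)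
    (h : MonotoneOn f (Icc a b) ∨ AntitoneOn f (Icc a b)) (hf : |f b - f a| ≤ δ) :
    eVariationOn f (Icc a b) ≤ ENNReal.ofReal δ := by
  have ha : a ∈ Icc a b := ⟨le_rfl, hab⟩
  have hb : b ∈ Icc a b := ⟨hab, le_rfl⟩
  rw [abs_le] at hf
  rcases h with h | h
  · have := h.eVariationOn_eq ha hb
    rw [inter_self] at this
    exact this.trans_le (ENNReal.ofReal_le_ofReal hf.2)
  · have := h.neg.eVariationOn_eq ha hb
    rw [inter_self] at this
    rw [← eVariationOn_neg]
    refine this.trans_le (ENNReal.ofReal_le_ofReal ?_)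
    linarith

theorem monotone_or_antitone_clamp_affine (l c m : ℝ) (a : ℝ) (s : Set ℝ) :
    MonotoneOn (fun y => a + max 0 (min l (c + y * m))) s ∨
      AntitoneOn (fun y => a + max 0 (min l (c + y * m))) s := by
  rcases le_total 0 m with h | h
  · left
    intro y _ y' _ hy
    have := mul_le_mul_of_nonneg_right hy h
    dsimp only
    gcongr
  · right
    intro y _ y' _ hy
    have := mul_le_mul_of_nonpos_right hy h
    dsimp only
    gcongr

/-- The foot on a short edge of a point moving along a polygonal curve has small variation. -/
theorem eVariationOn_footParam_le {d : ℕ} (A B : PolyCurve d) {i : ℕ} {δ : ℝ}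
    (hδ : A.edgeLen i ≤ δ) :
    eVariationOn (fun y => A.footParam i (B.param y)) (Icc 0 B.length) ≤ B.n * ENNReal.ofReal δ := by
  have hsum := eVariationOn.sum (fun y => A.footParam i (B.param y)) (s := univ) B.arc_mono
    (n := B.n) (fun _ _ _ => mem_univ _)
  simp only [univ_inter, B.arc_zero] at hsum
  rw [PolyCurve.length, ← hsum, ← nsmul_eq_mul]
  refine (Finset.sum_le_card_nsmul _ _ (ENNReal.ofReal δ) fun k hk => ?_).trans_eq
    (by rw [Finset.card_range])
  rw [Finset.mem_range] at hk
  -- On one edge of `B` the foot is an affine function clamped to an interval of length at most δ,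
  -- hence monotone or antitone with variation at most δ.
  have hc : EqOn (fun y => A.footParam i (B.param y)) (fun y => A.arc i + max 0 (min (A.edgeLen i)
      (inner ℝ (B.vtx k - B.arc k • B.dir k - A.vtx i) (A.dir i)
        + y * inner ℝ (B.dir k) (A.dir i)))) (Icc (B.arc k) (B.arc (k + 1))) := by
    intro y hy
    simp only [PolyCurve.footParam, B.param_eq hk hy]
    rw [← real_inner_smul_left, ← inner_add_left, sub_smul]
    congr 5
    abel
  refine eVariationOn_Icc_le_of_monotoneOn_or_antitoneOn (B.arc_mono k.le_succ) ?_ ?_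
  · exact (monotone_or_antitone_clamp_affine _ _ _ _ _).imp (fun h => h.congr hc.symm)
      fun h => h.congr hc.symm
  · have h1 := A.footParam_mem i (B.param (B.arc k))
    have h2 := A.footParam_mem i (B.param (B.arc (k + 1)))
    have h3 := A.arc_succ i
    rw [abs_le]
    constructor <;> linarith [h1.1, h1.2, h2.1, h2.2]

/-- The variation is measured along the edges of the original curve `B₀`, so the bound does not grow
with the number of vertices of `B`. -/
theorem sum_abs_footParam_sub_le {d : ℕ} {A B B₀ : PolyCurve d} (hB : B₀.Refines B) {i : ℕ} {δ : ℝ}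
    (hδ : A.edgeLen i ≤ δ) {j j' : ℕ} (hj' : j' ≤ B.n) :
    ∑ k ∈ Finset.Ico j j', |A.footParam i (B.vtx (k + 1)) - A.footParam i (B.vtx k)|
      ≤ B₀.n * δ := by
  have hδ0 : 0 ≤ δ := (A.edgeLen_nonneg i).trans hδ
  have h := eVariationOn.sum_le_of_monotoneOn_Icc (f := fun y => A.footParam i (B₀.param y))
    (s := Icc 0 B₀.length) (m := j) (n := j') (u := B.arc) (fun _ _ _ _ h => B.arc_mono h)
    fun k hk => ⟨B.arc_nonneg k, hB.length_eq ▸ B.arc_le_length (hk.2.trans hj')⟩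
  have h' := h.trans (eVariationOn_footParam_le A B₀ hδ)
  have e : ∀ k ∈ Finset.Ico j j', edist (A.footParam i (B₀.param (B.arc (k + 1))))
      (A.footParam i (B₀.param (B.arc k)))
      = ENNReal.ofReal |A.footParam i (B.vtx (k + 1)) - A.footParam i (B.vtx k)| := by
    intro k hk
    rw [Finset.mem_Ico] at hk
    rw [edist_dist, Real.dist_eq, ← hB.param_eq, B.param_arc (by omega), B.param_arc (by omega)]
  rw [Finset.sum_congr rfl e, ← ENNReal.ofReal_sum_of_nonneg fun _ _ => abs_nonneg _,
    ← ENNReal.ofReal_natCast, ← ENNReal.ofReal_mul (Nat.cast_nonneg _)] at h'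
  exact (ENNReal.ofReal_le_ofReal_iff (by positivity)).1 h'

/-! ### Following an axis-parallel segment in the VE graph -/

theorem mul_meanElev_vertical {d : ℕ} (A B : PolyCurve d) (x y y' : ℝ) :
    (y' - y) * meanElev A B (x, y) (x, y') = ∫ s in y..y', elev A B (x, s) := by
  have := intervalIntegral.smul_integral_comp_add_mul (a := 0) (b := 1)
    (fun s => elev A B (x, s)) (y' - y) y
  simp only [mul_zero, add_zero, mul_one, add_sub_cancel, smul_eq_mul] at this
  rw [← this, meanElev]
  congr 2
  funext t
  congr 1
  ext <;> simp [AffineMap.lineMap_apply]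
  ring

/-- The vertical leg is compared with the elevation on the line at `x`. The horizontal leg is
bounded crudely, since only the sum of the horizontal movements has to be small. -/
theorem segPrice_le_vertical {d : ℕ} (A B : PolyCurve d) {z w : ℝ × ℝ} {x δ : ℝ}
    (hzw : z.2 ≤ w.2) (hz : |z.1 - x| ≤ δ) (hw : |w.1 - x| ≤ δ) :
    segPrice A B z w ≤ (∫ y in z.2..w.2, elev A B (x, y)) + δ * (w.2 - z.2)
      + elevBound A B * |w.1 - z.1| := by
  have h1 : meanElev A B z w ≤ meanElev A B (x, z.2) (x, w.2) + δ + 0 :=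
    meanElev_le_add A B hz hw (by simp) (by simp)
  have h0 := sub_nonneg.2 hzw
  have h2 := mul_le_mul_of_nonneg_left h1 h0
  have h3 := mul_le_mul_of_nonneg_left (meanElev_le_elevBound A B z w) (abs_nonneg (w.1 - z.1))
  rw [segPrice_eq, abs_of_nonneg h0, ← mul_meanElev_vertical]
  linarith

theorem continuous_elev_right {d : ℕ} (A B : PolyCurve d) (x : ℝ) :
    Continuous fun y => elev A B (x, y) :=
  (continuous_elev A B).comp (by fun_prop)

/-- There is a directed path from `u` to the target of price at most `c`. -/
def ToGo {d : ℕ} (A B : PolyCurve d) (u : VENode) (c : ℝ) : Prop :=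
  ∃ l, (u :: l).IsChain (VEAdj A B) ∧ (∃ v ∈ (u :: l).getLast?, IsTarget A B v) ∧
    polyPrice A B (trace A B (u :: l)) ≤ c

theorem ToGo.mono {d : ℕ} {A B : PolyCurve d} {u : VENode} {c c' : ℝ} (h : ToGo A B u c)
    (hc : c ≤ c') : ToGo A B u c' := by
  obtain ⟨l, h1, h2, h3⟩ := h
  exact ⟨l, h1, h2, h3.trans hc⟩

theorem ToGo.cons {d : ℕ} {A B : PolyCurve d} {u v : VENode} {c : ℝ} (h : ToGo A B v c)
    (huv : VEAdj A B u v) : ToGo A B u (segPrice A B (loc A B u) (loc A B v) + c) := by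
  obtain ⟨l, h1, h2, h3⟩ := h
  refine ⟨v :: l, List.isChain_cons_cons.2 ⟨huv, h1⟩, by simpa using h2, ?_⟩
  simp only [trace, List.map_cons, polyPrice] at h3 ⊢
  gcongr

theorem polyPrice_swap {d : ℕ} (A B : PolyCurve d) (l : List (ℝ × ℝ)) :
    polyPrice B A (l.map Prod.swap) = polyPrice A B l := by
  induction l with
  | nil => rfl
  | cons z l ih =>
    cases l with
    | nil => rfl
    | cons w l =>
      simp only [List.map_cons, polyPrice] at ih ⊢
      rw [ih, segPrice_swap]

theorem ToGo.swap {d : ℕ} {A B : PolyCurve d} {u : VENode} {c : ℝ} (h : ToGo A B u c) :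
    ToGo B A u.swap c := by
  obtain ⟨l, h1, ⟨v, hv, hv'⟩, h3⟩ := h
  refine ⟨l.map VENode.swap, ?_, ⟨v.swap, ?_, ?_⟩, ?_⟩
  · rw [← List.map_cons, List.isChain_map]
    exact h1.imp fun _ _ => veAdj_swap
  · rw [← List.map_cons, List.getLast?_map, Option.mem_def.1 hv]
    rfl
  · rcases hv' with rfl | rfl
    · exact Or.inr rfl
    · exact Or.inl rfl
  · refine le_of_eq_of_le ?_ h3
    rw [← polyPrice_swap, trace, trace, ← List.map_cons, List.map_map, List.map_map]
    congr 2
    funext u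
    simp [loc_swap]

/-- From both entrances of the cell `(i, j)` one can reach the target at price at most `c`. -/
def CellToGo {d : ℕ} (A B : PolyCurve d) (i j : ℕ) (c : ℝ) : Prop :=
  ToGo A B (.vert i j) c ∧ ToGo A B (.horiz i j) c

theorem CellToGo.mono {d : ℕ} {A B : PolyCurve d} {i j : ℕ} {c c' : ℝ} (h : CellToGo A B i j c)
    (hc : c ≤ c') : CellToGo A B i j c' := ⟨h.1.mono hc, h.2.mono hc⟩

theorem CellToGo.swap {d : ℕ} {A B : PolyCurve d} {i j : ℕ} {c : ℝ} (h : CellToGo A B i j c) :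
    CellToGo B A j i c := ⟨h.2.swap, h.1.swap⟩

theorem segPrice_le_of_adj {d : ℕ} {A B : PolyCurve d} {δ : ℝ} (hA : A.MeshLE δ)
    (hB : B.MeshLE δ) {u v : VENode} (h : VEAdj A B u v) :
    segPrice A B (loc A B u) (loc A B v) ≤ 2 * δ * elevBound A B := by
  obtain ⟨i, hi, j, hj, hu, hv⟩ := h
  have hA1 := A.arc_succ i
  have hB1 := B.arc_succ j
  have hA2 := hA i hi
  have hB2 := hB j hj
  have hAe := A.edgeLen_nonneg i
  have hBe := B.edgeLen_nonneg j
  have h1 : (loc A B u).1 ∈ Icc (A.arc i) (A.arc (i + 1)) ∧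
      (loc A B u).2 ∈ Icc (B.arc j) (B.arc (j + 1)) := by
    rcases hu with rfl | rfl
    · refine ⟨?_, (loc_vert A B i j).2⟩
      rw [(loc_vert A B i j).1]; constructor <;> linarith
    · refine ⟨(loc_horiz A B i j).1, ?_⟩
      rw [(loc_horiz A B i j).2]; constructor <;> linarith
  have h2 : (loc A B v).1 ∈ Icc (A.arc i) (A.arc (i + 1)) ∧
      (loc A B v).2 ∈ Icc (B.arc j) (B.arc (j + 1)) := by
    rcases hv with rfl | rfl
    · refine ⟨?_, (loc_vert A B (i + 1) j).2⟩
      rw [(loc_vert A B (i + 1) j).1]; constructor <;> linarith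
    · refine ⟨(loc_horiz A B i (j + 1)).1, ?_⟩
      rw [(loc_horiz A B i (j + 1)).2]; constructor <;> linarith
  have h3 : |(loc A B v).1 - (loc A B u).1| ≤ δ := by
    rw [abs_le]; constructor <;> linarith [h1.1.1, h1.1.2, h2.1.1, h2.1.2]
  have h4 : |(loc A B v).2 - (loc A B u).2| ≤ δ := by
    rw [abs_le]; constructor <;> linarith [h1.2.1, h1.2.2, h2.2.1, h2.2.2]
  rw [segPrice_eq]
  have := meanElev_nonneg A B (loc A B u) (loc A B v)
  exact mul_le_mul (by linarith) (meanElev_le_elevBound _ _ _ _) this (by linarith)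

/-- Both entrances of a cell are joined to each of its exits, so one extra edge allows the direction
of travel to change. -/
theorem CellToGo.of_next {d : ℕ} {A B : PolyCurve d} {δ : ℝ} (hA : A.MeshLE δ)
    (hB : B.MeshLE δ) {i j : ℕ} (hi : i < A.n) (hj : j < B.n) {c : ℝ} {v : VENode}
    (hv : v = .vert (i + 1) j ∨ v = .horiz i (j + 1)) (h : ToGo A B v c) :
    CellToGo A B i j (2 * δ * elevBound A B + c) := by
  have h1 : VEAdj A B (.vert i j) v := ⟨i, hi, j, hj, Or.inl rfl, hv⟩
  have h2 : VEAdj A B (.horiz i j) v := ⟨i, hi, j, hj, Or.inr rfl, hv⟩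
  exact ⟨(h.cons h1).mono (by linarith [segPrice_le_of_adj hA hB h1]),
    (h.cons h2).mono (by linarith [segPrice_le_of_adj hA hB h2])⟩

theorem loc_horiz_of_interior {d : ℕ} (A B : PolyCurve d) (i : ℕ) {j : ℕ} (hj : 0 < j)
    (hj' : j < B.n) : loc A B (.horiz i j) = (A.footParam i (B.vtx j), B.arc j) := by
  rw [loc, if_neg (by omega), if_neg (by omega)]

/-- The path climbs within column `i` through the portals on its horizontal edges. The bounds `0 <
j` and `j' < B.n` keep away from the portals moved to the corners, so every location is a foot. -/
theorem ToGo.horiz {d : ℕ} {A B : PolyCurve d} {δ : ℝ} (hA : A.MeshLE δ) {i : ℕ} (hi : i < A.n)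
    {x : ℝ} (hx : x ∈ Icc (A.arc i) (A.arc (i + 1))) {j j' : ℕ} (hj : 0 < j) (hjj' : j ≤ j')
    (hj' : j' < B.n) {c : ℝ} (h : ToGo A B (.horiz i j') c) :
    ToGo A B (.horiz i j) ((∫ y in B.arc j..B.arc j', elev A B (x, y))
      + δ * (B.arc j' - B.arc j) + elevBound A B *
        (∑ k ∈ Finset.Ico j j', |A.footParam i (B.vtx (k + 1)) - A.footParam i (B.vtx k)|) + c) := by
  induction j', hjj' using Nat.le_induction generalizing c with
  | base => simpa using h
  | succ m hm ih =>
    have hadj : VEAdj A B (.horiz i m) (.horiz i (m + 1)) :=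
      ⟨i, hi, m, by omega, Or.inr rfl, Or.inr rfl⟩
    refine (ih (by omega) (h.cons hadj)).mono ?_
    rw [loc_horiz_of_interior A B i (by omega) (by omega),
      loc_horiz_of_interior A B i (by omega) hj', Finset.sum_Ico_succ_top hm]
    have hc := continuous_elev_right A B x
    rw [← intervalIntegral.integral_add_adjacent_intervals
      (hc.intervalIntegrable (B.arc j) (B.arc m)) (hc.intervalIntegrable _ (B.arc (m + 1)))]
    have hfoot : ∀ p, |A.footParam i p - x| ≤ δ := by
      intro p
      have h1 := A.footParam_mem i p
      have h2 := A.arc_succ i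
      have h3 := hA i hi
      rw [abs_le]
      constructor <;> linarith [h1.1, h1.2, hx.1, hx.2]
    have hseg := segPrice_le_vertical A B (z := (A.footParam i (B.vtx m), B.arc m))
      (w := (A.footParam i (B.vtx (m + 1)), B.arc (m + 1))) (B.arc_mono m.le_succ)
      (hfoot _) (hfoot _)
    dsimp only at hseg
    linarith

/-- Bound for the excess price of following an axis-parallel segment in the VE graph. -/
def excess {d : ℕ} (A B : PolyCurve d) : ℝ :=
  A.length + B.length + elevBound A B * (A.n + B.n + 2)

theorem excess_nonneg {d : ℕ} (A B : PolyCurve d) : 0 ≤ excess A B := by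
  have := A.length_nonneg
  have := B.length_nonneg
  have := elevBound_nonneg A B
  unfold excess
  positivity

theorem elevBound_swap {d : ℕ} (A B : PolyCurve d) : elevBound B A = elevBound A B := by
  rw [elevBound, elevBound, ← elev_swap]
  simp only [Prod.swap_prod_mk]
  ring

theorem excess_swap {d : ℕ} (A B : PolyCurve d) : excess B A = excess A B := by
  rw [excess, excess, elevBound_swap]
  ring

theorem elevBound_eq_of_refines {d : ℕ} {A B A' B' : PolyCurve d} (hA : A.Refines A')
    (hB : B.Refines B') : elevBound A' B' = elevBound A B := by
  rw [elevBound, elevBound, elev_eq_of_refines hA hB, hA.length_eq, hB.length_eq]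

theorem CellToGo.vertical {d : ℕ} {A₀ B₀ A B : PolyCurve d} (hrA : A₀.Refines A)
    (hrB : B₀.Refines B) {δ : ℝ} (hA : A.MeshLE δ) (hB : B.MeshLE δ) {i j j' : ℕ}
    (hi : i < A.n) (hjj' : j ≤ j') (hj' : j' < B.n) {x y y' : ℝ}
    (hx : x ∈ Icc (A.arc i) (A.arc (i + 1))) (hyy' : y ≤ y') (hy : y ≤ B.arc (j + 1))
    (hy' : B.arc j' ≤ y') {c : ℝ} (h : CellToGo A B i j' c) :
    CellToGo A B i j ((∫ s in y..y', elev A₀ B₀ (x, s)) + δ * excess A₀ B₀ + c) := by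
  have hδ := hA.nonneg
  have hint : ∀ p q : ℝ, p ≤ q → 0 ≤ ∫ s in p..q, elev A₀ B₀ (x, s) := fun p q hpq =>
    intervalIntegral.integral_nonneg hpq fun _ _ => elev_nonneg _ _ _
  rcases hjj'.eq_or_lt with rfl | hlt
  · have := mul_nonneg hδ (excess_nonneg A₀ B₀)
    exact h.mono (by linarith [hint y y' hyy'])
  -- The first edge leads to the top of the starting cell, which accounts for the summand 2 in
  -- `excess`; from there the climb covers only part of `[y, y']`.
  · refine (CellToGo.of_next hA hB hi (by omega) (Or.inr rfl)
      (h.2.horiz hA hi hx j.succ_pos hlt hj')).mono ?_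
    have hs := sum_abs_footParam_sub_le hrB (A := A) (hA i hi) (j := j + 1) hj'.le
    have hE := elevBound_nonneg A₀ B₀
    have hEs := mul_le_mul_of_nonneg_left hs hE
    have hm : (∫ s in B.arc (j + 1)..B.arc j', elev A₀ B₀ (x, s))
        ≤ ∫ s in y..y', elev A₀ B₀ (x, s) :=
      intervalIntegral.integral_mono_interval hy (B.arc_mono hlt) hy'
        (MeasureTheory.ae_of_all _ fun _ => elev_nonneg _ _ _)
        ((continuous_elev_right A₀ B₀ x).intervalIntegrable _ _)
    have hl1 := B.arc_le_length hj'.le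
    have hl2 := B.arc_nonneg (j + 1)
    rw [hrB.length_eq] at hl1
    have hl : δ * (B.arc j' - B.arc (j + 1)) ≤ δ * (A₀.length + B₀.length) :=
      mul_le_mul_of_nonneg_left (by linarith [A₀.length_nonneg]) hδ
    have hn : 0 ≤ δ * (elevBound A₀ B₀ * A₀.n) := by positivity
    rw [elevBound_eq_of_refines hrA hrB, elev_eq_of_refines hrA hrB, excess]
    simp only [Nat.succ_eq_add_one] at *
    linarith

theorem CellToGo.horizontal {d : ℕ} {A₀ B₀ A B : PolyCurve d} (hrA : A₀.Refines A)
    (hrB : B₀.Refines B) {δ : ℝ} (hA : A.MeshLE δ) (hB : B.MeshLE δ) {i i' j : ℕ}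
    (hj : j < B.n) (hii' : i ≤ i') (hi' : i' < A.n) {x x' y : ℝ}
    (hy : y ∈ Icc (B.arc j) (B.arc (j + 1))) (hxx' : x ≤ x') (hx : x ≤ A.arc (i + 1))
    (hx' : A.arc i' ≤ x') {c : ℝ} (h : CellToGo A B i' j c) :
    CellToGo A B i j ((∫ s in x..x', elev A₀ B₀ (s, y)) + δ * excess A₀ B₀ + c) := by
  have := (CellToGo.vertical hrB hrA hB hA hj hii' hi' hy hxx' hx hx' h.swap).swap
  rw [excess_swap] at this
  refine this.mono (le_of_eq ?_)
  simp only [← elev_swap A₀ B₀, Prod.swap_prod_mk]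

/-! ### Following a staircase in the VE graph -/

/-- The index of the last edge starting not after `x`. -/
def PolyCurve.cellIndex {d : ℕ} (C : PolyCurve d) (x : ℝ) : ℕ :=
  open Classical in Nat.findGreatest (fun k => C.arc k ≤ x) (C.n - 1)

namespace PolyCurve

theorem cellIndex_lt {d : ℕ} (C : PolyCurve d) (x : ℝ) : C.cellIndex x < C.n := by
  have h : C.cellIndex x ≤ C.n - 1 := Nat.findGreatest_le _
  have := C.n_pos
  omega

theorem cellIndex_mono {d : ℕ} (C : PolyCurve d) {x x' : ℝ} (h : x ≤ x') :
    C.cellIndex x ≤ C.cellIndex x' :=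
  Nat.findGreatest_mono (fun _ hk => le_trans hk h) le_rfl

theorem mem_cellIndex {d : ℕ} (C : PolyCurve d) {x : ℝ} (hx : x ∈ Icc 0 C.length) :
    x ∈ Icc (C.arc (C.cellIndex x)) (C.arc (C.cellIndex x + 1)) := by
  constructor
  · exact Nat.findGreatest_spec (P := fun k => C.arc k ≤ x) (Nat.zero_le _)
      (by simpa [arc_zero] using hx.1)
  · by_contra! hlt
    have hn := C.cellIndex_lt x
    rcases Nat.lt_or_ge (C.cellIndex x + 1) C.n with h | h
    · exact Nat.findGreatest_is_greatest (P := fun k => C.arc k ≤ x) (n := C.n - 1)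
        (Nat.lt_succ_self _) (Nat.le_sub_one_of_lt h) hlt.le
    · have e : C.cellIndex x + 1 = C.n := by omega
      rw [e] at hlt
      exact hlt.not_ge hx.2

theorem cellIndex_zero {d : ℕ} (C : PolyCurve d) : C.cellIndex 0 = 0 := by
  have h := (C.mem_cellIndex ⟨le_rfl, C.length_nonneg⟩).1
  by_contra hne
  obtain ⟨k, hk⟩ := Nat.exists_eq_succ_of_ne_zero hne
  rw [hk] at h
  have h1 := C.arc_lt_arc_succ (k := k) (by have := C.cellIndex_lt 0; omega)
  have := C.arc_nonneg k
  simp only [Nat.succ_eq_add_one] at h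
  linarith

theorem cellIndex_length {d : ℕ} (C : PolyCurve d) : C.cellIndex C.length = C.n - 1 :=
  le_antisymm (Nat.findGreatest_le _)
    (Nat.le_findGreatest le_rfl (C.arc_le_length (Nat.sub_le _ _)))

end PolyCurve

/-- The price of the `k`-th step, horizontal and then vertical, of the staircase through the points
`P 0, P 1, …`. -/
def stairStep {d : ℕ} (A B : PolyCurve d) (P : ℕ → ℝ × ℝ) (k : ℕ) : ℝ :=
  (∫ x in (P k).1..(P (k + 1)).1, elev A B (x, (P k).2))
    + ∫ y in (P k).2..(P (k + 1)).2, elev A B ((P (k + 1)).1, y)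

/-- The path is built backward from the target, keeping both entrances of the cell of `P k`
available. The error counts two axis-parallel segments per step and one final edge. -/
theorem exists_isVEPath_le_stairs {d : ℕ} {A₀ B₀ A B : PolyCurve d} (hrA : A₀.Refines A)
    (hrB : B₀.Refines B) {δ : ℝ} (hA : A.MeshLE δ) (hB : B.MeshLE δ) {P : ℕ → ℝ × ℝ}
    (hP : Monotone P) {K : ℕ} (h0 : P 0 = (0, 0)) (hK : P K = (A₀.length, B₀.length)) :
    ∃ γ, IsVEPath A B γ ∧ polyPrice A B (trace A B γ)
      ≤ ∑ k ∈ Finset.range K, stairStep A₀ B₀ P k + δ * ((2 * K + 1) * excess A₀ B₀) := by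
  have hmem1 : ∀ k ≤ K, (P k).1 ∈ Icc 0 A.length := fun k hk => by
    have h1 := (hP (Nat.zero_le k)).1
    have h2 := (hP hk).1
    rw [h0] at h1
    rw [hK, ← hrA.length_eq] at h2
    exact ⟨h1, h2⟩
  have hmem2 : ∀ k ≤ K, (P k).2 ∈ Icc 0 B.length := fun k hk => by
    have h1 := (hP (Nat.zero_le k)).2
    have h2 := (hP hk).2
    rw [h0] at h1
    rw [hK, ← hrB.length_eq] at h2
    exact ⟨h1, h2⟩
  have hE := elevBound_nonneg A₀ B₀
  have hδ := hA.nonneg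
  have hbase : 2 * δ * elevBound A B ≤ δ * excess A₀ B₀ := by
    rw [elevBound_eq_of_refines hrA hrB, excess]
    have := A₀.length_nonneg
    have := B₀.length_nonneg
    have h1 : 0 ≤ δ * (A₀.length + B₀.length + elevBound A₀ B₀ * (A₀.n + B₀.n)) := by positivity
    linarith
  have key : ∀ r k, k + r = K → CellToGo A B (A.cellIndex (P k).1) (B.cellIndex (P k).2)
      (∑ s ∈ Finset.range r, stairStep A₀ B₀ P (k + s) + δ * ((2 * r + 1) * excess A₀ B₀)) := by
    intro r
    induction r with
    | zero =>
      rintro k rfl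
      rw [add_zero] at hK
      rw [hK, ← hrA.length_eq, ← hrB.length_eq, A.cellIndex_length, B.cellIndex_length]
      have hAn := A.n_pos
      have hBn := B.n_pos
      have ht : ToGo A B (.vert (A.n - 1 + 1) (B.n - 1)) 0 := ⟨[], by simp,
        ⟨.vert (A.n - 1 + 1) (B.n - 1), rfl, Or.inl (by rw [Nat.sub_add_cancel hAn])⟩,
        by simp [trace, polyPrice]⟩
      refine (CellToGo.of_next hA hB (by omega) (by omega) (Or.inl rfl) ht).mono ?_
      simpa using hbase
    | succ r ih =>
      intro k hk
      have hm := hP k.le_succ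
      have h1 := ih (k + 1) (by omega)
      -- Going backward, the vertical half of the step is treated before the horizontal half.
      have h2 := CellToGo.vertical hrA hrB hA hB (A.cellIndex_lt _) (B.cellIndex_mono hm.2)
        (B.cellIndex_lt _) (A.mem_cellIndex (hmem1 (k + 1) (by omega))) hm.2
        (B.mem_cellIndex (hmem2 k (by omega))).2 (B.mem_cellIndex (hmem2 (k + 1) (by omega))).1 h1
      have h3 := CellToGo.horizontal hrA hrB hA hB (B.cellIndex_lt _) (A.cellIndex_mono hm.1)
        (A.cellIndex_lt _) (B.mem_cellIndex (hmem2 k (by omega))) hm.1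
        (A.mem_cellIndex (hmem1 k (by omega))).2 (A.mem_cellIndex (hmem1 (k + 1) (by omega))).1 h2
      refine h3.mono (le_of_eq ?_)
      rw [Finset.sum_range_succ']
      simp only [add_zero, stairStep, Nat.succ_eq_add_one, add_assoc, add_comm 1, Nat.cast_add,
        Nat.cast_one]
      ring
  obtain ⟨l, hl1, hl2, hl3⟩ := (key K 0 (zero_add K)).1
  rw [h0, A.cellIndex_zero, B.cellIndex_zero] at hl1 hl2 hl3
  simp only [zero_add] at hl3
  exact ⟨_, ⟨hl1, ⟨_, rfl, Or.inl rfl⟩, hl2⟩, hl3⟩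

/-! ### Approximating a morphing by a staircase -/

theorem integral_elev_le_leashLeft {d : ℕ} {A B : PolyCurve d} {m : Morphing A B}
    (hm : m.IsMonotone) {s t : unitInterval} (hst : s ≤ t) {y ε : ℝ}
    (hy : y ∈ Icc (m.path s).2 (m.path t).2) (hε : (m.path t).2 - (m.path s).2 ≤ ε) :
    ∫ x in (m.path s).1..(m.path t).1, elev A B (x, y)
      ≤ (∫ x in (m.path s).1..(m.path t).1, leashLeft m x)
        + ε * ((m.path t).1 - (m.path s).1) := by
  have hi := intervalIntegrable_leashLeft m (m.path s).1 (m.path t).1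
  have hc : ∫ _ in (m.path s).1..(m.path t).1, ε = ε * ((m.path t).1 - (m.path s).1) := by
    rw [intervalIntegral.integral_const, smul_eq_mul, mul_comm]
  rw [← hc, ← intervalIntegral.integral_add hi intervalIntegrable_const]
  -- Over an interior abscissa, monotonicity confines the whole fibre to times in `[s, t]`, so its
  -- ordinates are within ε of `y`. Over the two end abscissas the fibre may extend beyond these
  -- times.
  refine intervalIntegral.integral_mono_on_of_le_Ioo (hm hst).1
    (Continuous.intervalIntegrable ((continuous_elev A B).comp (by fun_prop)) _ _)
    (hi.add intervalIntegrable_const) fun x hx => ?_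
  have hx' : x ∈ Prod.fst '' Set.range m.path := by
    rw [← Set.range_comp]
    exact mem_range_of_exists_le_of_exists_ge (continuous_fst.comp m.path.continuous)
      ⟨s, hx.1.le⟩ ⟨t, hx.2.le⟩
  obtain ⟨y', ⟨r, hr⟩, he⟩ := exists_leashLeft_eq m hx'
  have hr1 : (m.path r).1 = x := by rw [hr]
  have hr2 : (m.path r).2 = y' := by rw [hr]
  have hsr : s ≤ r := by
    by_contra! h
    exact absurd (hm h.le).1 (by rw [hr1]; exact hx.1.not_ge)
  have hrt : r ≤ t := by
    by_contra! h
    exact absurd (hm h.le).1 (by rw [hr1]; exact hx.2.not_ge)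
  have h1 := (hm hsr).2
  have h2 := (hm hrt).2
  rw [hr2] at h1 h2
  have h3 : |y - y'| ≤ ε := by
    rw [abs_le]; constructor <;> linarith [hy.1, hy.2]
  have h4 := elev_le_add A B (x, y) (x, y')
  simp only [sub_self, abs_zero, add_zero] at h4
  rw [he]
  linarith

theorem integral_elev_le_leashRight {d : ℕ} {A B : PolyCurve d} {m : Morphing A B}
    (hm : m.IsMonotone) {s t : unitInterval} (hst : s ≤ t) {x ε : ℝ}
    (hx : x ∈ Icc (m.path s).1 (m.path t).1) (hε : (m.path t).1 - (m.path s).1 ≤ ε) :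
    ∫ y in (m.path s).2..(m.path t).2, elev A B (x, y)
      ≤ (∫ y in (m.path s).2..(m.path t).2, leashRight m y)
        + ε * ((m.path t).2 - (m.path s).2) := by
  have e : ∀ u, m.swap.path u = (m.path u).swap := fun _ => rfl
  have e' : ∀ y, elev B A (y, x) = elev A B (x, y) := fun y => elev_swap A B (x, y)
  have h := integral_elev_le_leashLeft hm.swap hst (y := x) (ε := ε)
  simp only [e, Prod.fst_swap, Prod.snd_swap, leashLeft_swap, e'] at h
  exact h hx hε

/-- By uniform continuity, equally spaced times give consecutive points that differ by less than ε
in each coordinate. Each step then costs at most its share of the warping cost plus ε times its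
displacement, and both sums telescope. -/
theorem exists_stairs_le_warpingCost {d : ℕ} {A B : PolyCurve d} {m : Morphing A B}
    (hm : m.IsMonotone) {ε : ℝ} (hε : 0 < ε) :
    ∃ (P : ℕ → ℝ × ℝ) (K : ℕ), Monotone P ∧ P 0 = (0, 0) ∧ P K = (A.length, B.length) ∧
      ∑ k ∈ Finset.range K, stairStep A B P k ≤ warpingCost m + ε * (A.length + B.length) := by
  obtain ⟨η, hη, hη'⟩ := Metric.uniformContinuous_iff.1
    (CompactSpace.uniformContinuous_of_continuous m.path.continuous) ε hε
  obtain ⟨N, hN⟩ := exists_nat_one_div_lt hη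
  have hN0 : (0 : ℝ) < (N : ℝ) + 1 := by positivity
  let T : ℕ → unitInterval := fun k => projIcc 0 1 zero_le_one ((k : ℝ) / (N + 1))
  have hT : Monotone T := fun k k' h => monotone_projIcc _ (by gcongr)
  have hP : Monotone fun k => m.path (T k) := hm.comp hT
  have hT0 : T 0 = 0 := by simp [T, projIcc_left]
  have hT1 : T (N + 1) = 1 := by
    simp only [T, Nat.cast_add, Nat.cast_one, div_self hN0.ne', projIcc_right]
    rfl
  have hP0 : m.path (T 0) = (0, 0) := by rw [hT0]; exact m.path.source
  have hP1 : m.path (T (N + 1)) = (A.length, B.length) := by rw [hT1]; exact m.path.target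
  have hd : ∀ k, dist (m.path (T (k + 1))) (m.path (T k)) < ε := fun k => hη' <| by
    refine lt_of_le_of_lt ?_ hN
    refine (abs_projIcc_sub_projIcc zero_le_one).trans_eq ?_
    rw [← sub_div, Nat.cast_add, Nat.cast_one, add_sub_cancel_left, abs_of_nonneg (by positivity)]
  refine ⟨_, N + 1, hP, hP0, hP1, ?_⟩
  have hstep : ∀ k, stairStep A B (fun k => m.path (T k)) k
      ≤ ((∫ x in (m.path (T k)).1..(m.path (T (k + 1))).1, leashLeft m x)
          + ∫ y in (m.path (T k)).2..(m.path (T (k + 1))).2, leashRight m y)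
        + ε * (((m.path (T (k + 1))).1 + (m.path (T (k + 1))).2)
          - ((m.path (T k)).1 + (m.path (T k)).2)) := by
    intro k
    have hk := hT k.le_succ
    have hmk := hm hk
    have hdk := (hd k).le
    rw [Prod.dist_eq, max_le_iff, Real.dist_eq, Real.dist_eq] at hdk
    have h1 := integral_elev_le_leashLeft hm hk ⟨le_rfl, hmk.2⟩ ((le_abs_self _).trans hdk.2)
    have h2 := integral_elev_le_leashRight hm hk ⟨hmk.1, le_rfl⟩ ((le_abs_self _).trans hdk.1)
    simp only [Nat.succ_eq_add_one] at h1 h2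
    unfold stairStep
    linarith
  refine (Finset.sum_le_sum fun k _ => hstep k).trans_eq ?_
  have hL := intervalIntegral.sum_integral_adjacent_intervals (n := N + 1)
    (a := fun k => (m.path (T k)).1) fun k _ => intervalIntegrable_leashLeft m _ _
  have hR := intervalIntegral.sum_integral_adjacent_intervals (n := N + 1)
    (a := fun k => (m.path (T k)).2) fun k _ => intervalIntegrable_leashLeft m.swap _ _
  rw [leashLeft_swap] at hR
  rw [Finset.sum_add_distrib, Finset.sum_add_distrib, hL, hR, ← Finset.mul_sum,
    Finset.sum_range_sub (fun k => (m.path (T k)).1 + (m.path (T k)).2), hP0, hP1, warpingCost]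
  simp

/-! ### Upper bound and passage to the limit -/

theorem exists_isShortestVEPath_polyCurve {d : ℕ} (A B : PolyCurve d) :
    ∃ γ, IsShortestVEPath A B γ := by
  obtain ⟨M, -, hM⟩ := A.exists_meshLE
  obtain ⟨N, -, hN⟩ := B.exists_meshLE
  -- A staircase with a single step supplies some path; its price is irrelevant.
  obtain ⟨γ, hγ, -⟩ := exists_isVEPath_le_stairs (.refl A) (.refl B)
    (δ := max M N) (fun k hk => (hM k hk).trans (le_max_left _ _))
    (fun k hk => (hN k hk).trans (le_max_right _ _)) (K := 1)
    (P := fun k => if k = 0 then (0, 0) else (A.length, B.length))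
    (monotone_nat_of_le_succ fun k => by
      have h1 := A.length_nonneg
      have h2 := B.length_nonneg
      rcases k with _ | k <;> simp [h1, h2]) rfl rfl
  exact exists_isShortestVEPath ⟨γ, hγ⟩

/-- One third of η each goes to near-optimality of the morphing, to the staircase and to the VE
path. The staircase, and so `K`, is fixed before δ is chosen, which makes δ uniform over all
refinements. -/
theorem exists_mesh_polyPrice_le {d : ℕ} (A₀ B₀ : PolyCurve d) {η : ℝ} (hη : 0 < η) :
    ∃ δ > 0, ∀ A B : PolyCurve d, A₀.Refines A → B₀.Refines B → A.MeshLE δ → B.MeshLE δ →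
      ∀ γ, IsShortestVEPath A B γ → polyPrice A B (trace A B γ) ≤ cdtw A₀ B₀ + η := by
  have hl : 0 < A₀.length + B₀.length := add_pos A₀.length_pos B₀.length_pos
  obtain ⟨m, hm, hlt⟩ := exists_warpingCost_lt A₀ B₀
    (c := cdtw A₀ B₀ + η / 3) (by linarith)
  obtain ⟨P, K, hP, h0, hK, hsum⟩ := exists_stairs_le_warpingCost hm
    (ε := η / 3 / (A₀.length + B₀.length)) (by positivity)
  rw [div_mul_cancel₀ _ hl.ne'] at hsum
  have hE := excess_nonneg A₀ B₀
  have hpos : 0 < (2 * K + 1) * excess A₀ B₀ + 1 := by positivity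
  refine ⟨η / 3 / ((2 * K + 1) * excess A₀ B₀ + 1), by positivity,
    fun A B hrA hrB hA hB γ hγ => ?_⟩
  obtain ⟨γ', hγ', hle⟩ := exists_isVEPath_le_stairs hrA hrB hA hB hP h0 hK
  have h1 := hγ.2 γ' hγ'
  have h2 : η / 3 / ((2 * K + 1) * excess A₀ B₀ + 1) * ((2 * K + 1) * excess A₀ B₀) ≤ η / 3 := by
    rw [div_mul_eq_mul_div, div_le_iff₀ hpos]
    gcongr
    linarith
  linarith

end Sweep

end

theorem mainTheorem9 {d : ℕ} (π σ : Sweep.PolyCurve d) :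
    (∀ i : ℕ, Nonempty
      (Sweep.SweepRun (Sweep.PolyCurve.split^[i] π) (Sweep.PolyCurve.split^[i] σ))) ∧
    ∀ R : (i : ℕ) →
        Sweep.SweepRun (Sweep.PolyCurve.split^[i] π) (Sweep.PolyCurve.split^[i] σ),
      Tendsto (fun i => (R i).sweepDist) atTop (𝓝 (Sweep.cdtw π σ)) ∧
      Tendsto (fun i => (R i).pathPrice) atTop (𝓝 (Sweep.cdtw π σ)) := by
  refine ⟨fun i => ?_, fun R => ?_⟩
  · obtain ⟨γ, hγ⟩ := Sweep.exists_isShortestVEPath_polyCurve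
      (Sweep.PolyCurve.split^[i] π) (Sweep.PolyCurve.split^[i] σ)
    exact ⟨⟨_, _, .refl, γ, hγ⟩⟩
  obtain ⟨M, -, hM⟩ := π.exists_meshLE
  obtain ⟨N, -, hN⟩ := σ.exists_meshLE
  let δ : ℕ → ℝ := fun i => max M N / 2 ^ i
  have hδ : Tendsto δ atTop (𝓝 0) :=
    tendsto_const_nhds.div_atTop (tendsto_pow_atTop_atTop_of_one_lt one_lt_two)
  have hrA : ∀ i, π.Refines (R i).A' := fun i =>
    (π.refines_split_iterate i).trans (R i).refines.1
  have hrB : ∀ i, σ.Refines (R i).B' := fun i =>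
    (σ.refines_split_iterate i).trans (R i).refines.2
  have hmA : ∀ i, (R i).A'.MeshLE (δ i) := fun i =>
    (Sweep.PolyCurve.MeshLE.split_iterate (fun k hk => (hM k hk).trans (le_max_left _ _)) i).of_refines
      (R i).refines.1
  have hmB : ∀ i, (R i).B'.MeshLE (δ i) := fun i =>
    (Sweep.PolyCurve.MeshLE.split_iterate (fun k hk => (hN k hk).trans (le_max_right _ _)) i).of_refines
      (R i).refines.2
  have hup : ∀ η > 0, ∀ᶠ i in atTop, (R i).pathPrice ≤ Sweep.cdtw π σ + η := by
    intro η hη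
    obtain ⟨δ₀, hδ₀, h⟩ := Sweep.exists_mesh_polyPrice_le π σ hη
    filter_upwards [hδ.eventually_le_const hδ₀] with i hi
    exact h _ _ (hrA i) (hrB i) (fun k hk => (hmA i k hk).trans hi)
      (fun k hk => (hmB i k hk).trans hi) _ (R i).shortest
  have hlow : ∀ i, Sweep.cdtw π σ ≤ (R i).sweepDist := fun i =>
    (R i).shortest.1.cdtw_le (hrA i) (hrB i)
  have hmid : ∀ i, (R i).sweepDist
      ≤ (R i).pathPrice + 2 * δ i * (π.length + σ.length) := fun i => by
    have := (R i).shortest.1.polyPrice_monotonize_le (hmA i) (hmB i)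
    rwa [(hrA i).length_eq, (hrB i).length_eq] at this
  have herr : Tendsto (fun i => 2 * δ i * (π.length + σ.length)) atTop (𝓝 0) := by
    simpa using (hδ.const_mul 2).mul_const (π.length + σ.length)
  -- The path price is at most `cdtw` + η/3, and the monotonization error is below η/3. Hence the
  -- sweep distance is at least `cdtw` and below `cdtw` + 2η/3, and the path price is above `cdtw` −
  -- η/3.
  constructor <;> rw [Metric.tendsto_nhds] <;> intro η hη <;>
    filter_upwards [hup (η / 3) (by positivity),
      herr.eventually_lt_const (show (0 : ℝ) < η / 3 by positivity)] with i h1 h2 <;>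
    have h3 := hlow i <;> have h4 := hmid i <;> rw [Real.dist_eq, abs_lt] <;>
    constructor <;> linarith
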